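/- Let $0<\mu<1$, let $a,b,c,\alpha\in\mathbb R$ with $\alpha\neq0$, and let $D^\mu f(t)=\frac1{\Gamma(1-\mu)}\int_0^t\frac{f'(\tau)}{(t-\tau)^{\mu}}\,d\tau$ be the Caputo derivative of order $\mu$ with lower terminal $0$. A solution of a system $D^\mu v=F$ on $[0,\infty)$ is a function $v:[0,\infty)\to\mathbb R^3$, absolutely continuous on every $[0,T]$, for which the defining integral converges and the equation holds at every $t>0$. Let $$F(v)=\bigl(a(v_2-v_1),\ (c-a)v_1-v_1v_3+cv_2,\ v_1v_2-bv_3\bigr)$$ be the Chen vector field. Consider two drives $D^\mu x=F(x)$, $D^\mu y=F(y)$ and two responses $D^\mu z=F(z)+(u_1,u_2,u_3)$, $D^\mu w=F(w)+(u_4,u_5,u_6)$, and put $$e_1=(x_1+y_1)-(z_1+w_1),\quad e_2=(x_2+y_2)+(z_2+w_2),\quad e_3=(x_3+y_3)-\alpha(z_3+w_3).$$ Let $C$ be a constant real $3\times3$ matrix, let $V=Ce$, and let $$\begin{aligned}U_1&=-V_1+2a(x_2+y_2),\\ U_2&=V_2-2c(z_1+w_1)+2a(x_1+y_1)+x_1x_3+y_1y_3+z_1z_3+w_1w_3,\\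 U_3&=\tfrac1\alpha\bigl[-V_3+x_1x_2+y_1y_2-\alpha z_1z_2-\alpha w_1w_2\bigr].\end{aligned}$$ Suppose that for all $t>0$ the controls are those of case 1, $u_i=u_{i+3}=\tfrac12U_i$ ($i=1,2,3$), or that for all $t>0$ they are those of case 2, $u_i=U_i$ and $u_{i+3}=0$ ($i=1,2,3$). Put $$A=\begin{pmatrix}-a&-a&0\\a+c&c&0\\0&0&-b\end{pmatrix}.$$ Then, for all solutions $x,y,z,w$ on $[0,\infty)$, with any initial values: 1. $e$ is a solution on $[0,\infty)$ of the linear system $D^\mu e=(A+C)e$. 2. If every complex eigenvalue $s$ of $A+C$ satisfies $|\arg s|>\mu\pi/2$ (with $\arg s\in(-\pi,\pi]$ and $\arg 0:=0$), then $e_1(t)\to0$, $e_2(t)\to0$ and $e_3(t)\to0$ as $t\to\infty$; that is, complete, anti- and projective synchronization hold at the same time. Moreover, for $\ell\in\mathbb R$, the matrix $$C=\begin{pmatrix}c-\ell&a&0\\-(a+c)&-(c+\ell)&0\\0&0&b-\ell\end{pmatrix}$$ satisfies the eigenvalue condition in 2 if and only if $\ell>0$ and $\ell>c-a$; and the matrix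 obtained from it by replacing the upper left entry with $a-\ell$, for which $A+C=-\ell I$, satisfies it if and only if $\ell>0$. -/

import Mathlib

open Filter Topology MeasureTheory

/-- `f` has Caputo fractional derivative `v` of order `μ ∈ (0, 1)` at time `t`, with lower
terminal `0`: the defining integral converges and
`v = (1 / Γ(1 - μ)) ∫_0^t f'(τ) / (t - τ)^μ dτ`. -/
structure HasCaputoDerivAt (μ : ℝ) (f : ℝ → ℝ) (v t : ℝ) : Prop where
  intervalIntegrable : IntervalIntegrable (fun τ => deriv f τ / (t - τ) ^ μ) volume 0 t
  eq_integral : v = 1 / Real.Gamma (1 - μ) * ∫ τ in (0 : ℝ)..t, deriv f τ / (t - τ) ^ μ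

/-- `x` is a solution on `[0, ∞)` of the commensurate system `D^μ x(t) = F(t)` in `ℝ³`:
each component is absolutely continuous on every `[0, T]` (so that `x'` exists almost
everywhere and is locally integrable) and the equation holds at every `t > 0`. -/
structure IsCaputoSolution (μ : ℝ) (x F : ℝ → Fin 3 → ℝ) : Prop where
  absolutelyContinuous : ∀ i, ∀ T > 0, AbsolutelyContinuousOnInterval (fun t => x t i) 0 T
  hasCaputoDerivAt : ∀ t > 0, ∀ i, HasCaputoDerivAt μ (fun s => x s i) (F t i) t

/-- The Chen vector field with parameters `a, b, c`. -/
def chenField (a b c : ℝ) (v : Fin 3 → ℝ) : Fin 3 → ℝ :=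
  ![a * (v 1 - v 0),
    (c - a) * v 0 - v 0 * v 2 + c * v 1,
    v 0 * v 1 - b * v 2]

/-- The combination errors `e₁, e₂, e₃` of two drive states `x, y` and two response states
`z, w`, with projective scaling factor `α`. -/
def syncError (α : ℝ) (x y z w : Fin 3 → ℝ) : Fin 3 → ℝ :=
  ![(x 0 + y 0) - (z 0 + w 0),
    (x 1 + y 1) + (z 1 + w 1),
    (x 2 + y 2) - α * (z 2 + w 2)]

/-- The total active control `(u₁ + u₄, u₂ + u₅, u₃ + u₆)`, for linear inputs `V`. -/
noncomputable def totalControl (a c α : ℝ) (V x y z w : Fin 3 → ℝ) : Fin 3 → ℝ :=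
  ![-V 0 + 2 * a * (x 1 + y 1),
    V 1 - 2 * c * (z 0 + w 0) + 2 * a * (x 0 + y 0)
      + x 0 * x 2 + y 0 * y 2 + z 0 * z 2 + w 0 * w 2,
    1 / α * (-V 2 + x 0 * x 1 + y 0 * y 1 - α * z 0 * z 1 - α * w 0 * w 1)]

/-- Case 1: the controls `((u₁, u₂, u₃), (u₄, u₅, u₆))` when the load is split equally
between the two responses. -/
noncomputable def controlsCase1 (a c α : ℝ) (V x y z w : Fin 3 → ℝ) :
    (Fin 3 → ℝ) × (Fin 3 → ℝ) :=
  ((1 / 2 : ℝ) • totalControl a c α V x y z w, (1 / 2 : ℝ) • totalControl a c α V x y z w)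

/-- Case 2: the controls `((u₁, u₂, u₃), (u₄, u₅, u₆))` when the first response carries all
of the control. -/
noncomputable def controlsCase2 (a c α : ℝ) (V x y z w : Fin 3 → ℝ) :
    (Fin 3 → ℝ) × (Fin 3 → ℝ) :=
  (totalControl a c α V x y z w, 0)

/-- The coefficient matrix `A` of the uncontrolled error system `D^μ e = A e + V`. -/
def errorMatrix (a b c : ℝ) : Matrix (Fin 3) (Fin 3) ℝ :=
  !![-a, -a, 0;
     a + c, c, 0;
     0, 0, -b]

/-- The gain matrix of the design, with tuning parameter `l`. -/
def gainMatrix (a b c l : ℝ) : Matrix (Fin 3) (Fin 3) ℝ :=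
  !![c - l, a, 0;
     -(a + c), -(c + l), 0;
     0, 0, b - l]

/-- The gain matrix with upper left entry `a - l`, for which `A + C = -l I`. -/
def gainMatrix' (a b c l : ℝ) : Matrix (Fin 3) (Fin 3) ℝ :=
  !![a - l, a, 0;
     -(a + c), -(c + l), 0;
     0, 0, b - l]

/-- Every complex eigenvalue `s` of `M` satisfies `|arg s| > μπ/2`. (`Complex.arg 0 = 0`, so
`0` is not allowed as an eigenvalue when `μ > 0`.) -/
def SectorCondition (μ : ℝ) (M : Matrix (Fin 3) (Fin 3) ℝ) : Prop :=
  ∀ s ∈ spectrum ℂ (M.map Complex.ofReal), μ * Real.pi / 2 < |s.arg|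

/-!
The error is a fixed linear combination of the four states, and the Caputo derivative is linear on
absolutely continuous functions, so a direct computation, in which only the sum of the two controls
matters, gives `D^μ e = (A + C) e` (`isCaputoSolution_syncError`). With the two special gain matrices
`A + C` is a real diagonal matrix, and a real number satisfies the sector condition if and only if it
is negative.

The analytic content is Matignon's theorem (`IsCaputoSolution.tendsto_zero`): solutions of
`D^μ e = M e` tend to zero under the sector condition. Pairing `e` with generalized eigenvectors of
the transpose of `M` reduces it to the scalar equation `D^μ y = l y + g` with `|arg l| > μ π / 2` and
`g → 0` (`tendsto_zero_of_caputo_linear`).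

For the scalar equation, let `r` be the function with Laplace transform `1 / (p ^ μ - l)`. If `r` is
integrable on `(0, ∞)`, then `y = y 0 + r * (g + l y 0)` tends to `y 0 + l (y 0) ∫ r = 0`, because
`∫ r = -1 / l` is the value of the transform at `p = 0`. The formula for `y`
(`ae_eq_of_caputo_linear`) follows from the resolvent equation `r * k = 1 + l (r * 1)`, where
`k t = t ^ (-μ) / Γ (1 - μ)`. Both of its sides have the same Laplace transform, and Lerch's theorem
(`ae_eq_zero_of_laplace_nat_eq_zero`) applies. No Mittag-Leffler function and no Volterra form of the
equation is needed.

The sector condition enters in the construction of `r` (`exists_integrable_laplace_eq`). It says that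
there is an angle `θ > π / 2` such that `s ^ μ = l` has no solution with `|arg s| ≤ θ`, so the inverse
Laplace integral may be taken over the rays `arg s = ±θ`, on which `exp (s t)` decays. In the variable
`w = log s` these rays are the boundary lines of a strip, and Cauchy's formula there
(`integral_strip_mul_eq`) computes the Laplace transform. To make the double integral over `s` and `t`
absolutely convergent near `s = 0`, the transform is corrected by `1 / (l (1 + s))`, which stands for
the explicit function `exp (-t) / l`.
-/

/-! ### Cauchy's formula on a strip -/

/-- If the sector `|arg s| ≤ ν θ` does not contain `l`, then the distance from `l` to a point `u` of
the sector is at least a constant times `1 + |u|`; here `u = exp (ν w)`. -/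
lemma exists_le_norm_cexp_mul_sub {ν θ : ℝ} {l : ℂ} (hν : 0 < ν) (hθ : 0 ≤ θ)
    (h : ν * θ < |l.arg|) :
    ∃ δ > 0, ∀ w : ℂ, |w.im| ≤ θ →
      δ * (1 + Real.exp (ν * w.re)) ≤ ‖Complex.exp (ν * w) - l‖ := by
  have hνθ : 0 ≤ ν * θ := by positivity
  have hl : l ≠ 0 := by
    rintro rfl
    simp at h
    linarith
  set m := ‖l‖
  have hm : 0 < m := norm_pos_iff.mpr hl
  have hargle := Complex.abs_arg_le_pi l
  set β := |l.arg| - ν * θ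
  have hβ : 0 < β := sub_pos.mpr h
  have hβπ : β ≤ Real.pi := by simp only [β]; linarith
  -- `κ` bounds the cosine of the angle between `exp (ν w)` and `l`
  set κ := Real.cos β
  have hκ : κ < 1 := by
    have := Real.cos_lt_cos_of_nonneg_of_le_pi le_rfl hβπ hβ
    simpa using this
  refine ⟨min 1 m * √((1 - κ) / 2), by have : 0 < (1 - κ) / 2 := by linarith
                                       positivity, fun w hw => ?_⟩
  set r := Real.exp (ν * w.re)
  have hr : 0 < r := Real.exp_pos _
  have hcos : Real.cos (ν * w.im - l.arg) ≤ κ := by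
    have h1 : |ν * w.im| ≤ ν * θ := by
      rw [abs_mul, abs_of_pos hν]; gcongr
    have h2 : β ≤ |ν * w.im - l.arg| := by
      have := abs_sub_abs_le_abs_sub l.arg (ν * w.im)
      rw [abs_sub_comm] at this
      simp only [β]; linarith
    have h3 : |ν * w.im - l.arg| ≤ 2 * Real.pi - β := by
      have := abs_sub (ν * w.im) l.arg
      simp only [β]; linarith
    rw [← Real.cos_abs]
    rcases le_total |ν * w.im - l.arg| Real.pi with h4 | h4
    · exact Real.cos_le_cos_of_nonneg_of_le_pi hβ.le h4 h2
    · rw [← Real.cos_two_pi_sub]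
      exact Real.cos_le_cos_of_nonneg_of_le_pi hβ.le (by linarith) (by linarith)
  have hsq : (1 - κ) / 2 * (r + m) ^ 2 ≤ ‖Complex.exp (ν * w) - l‖ ^ 2 := by
    have e1 : ‖Complex.exp (ν * w) - l‖ ^ 2
        = r ^ 2 + m ^ 2 - 2 * (r * m) * Real.cos (ν * w.im - l.arg) := by
      rw [Complex.sq_norm, Complex.normSq_apply, Real.cos_sub]
      have ha : l.re = m * Real.cos l.arg := (Complex.norm_mul_cos_arg l).symm
      have hb : l.im = m * Real.sin l.arg := (Complex.norm_mul_sin_arg l).symm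
      simp only [Complex.sub_re, Complex.sub_im, Complex.exp_re, Complex.exp_im,
        Complex.re_ofReal_mul, Complex.im_ofReal_mul]
      rw [ha, hb]
      change (r * _ - _) * (r * _ - _) + (r * _ - _) * (r * _ - _) = _
      linear_combination r ^ 2 * Real.sin_sq_add_cos_sq (ν * w.im)
        + m ^ 2 * Real.sin_sq_add_cos_sq l.arg
    rw [e1]
    have h1 : r * m * Real.cos (ν * w.im - l.arg) ≤ r * m * κ := by gcongr
    have h2 : -1 ≤ κ := Real.neg_one_le_cos _
    nlinarith [mul_nonneg (by linarith : 0 ≤ 1 + κ) (sq_nonneg (r - m))]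
  have h1 : √((1 - κ) / 2) * (r + m) ≤ ‖Complex.exp (ν * w) - l‖ := by
    have h0 : 0 ≤ (1 - κ) / 2 := by linarith
    rw [← Real.sqrt_sq (by positivity : 0 ≤ r + m), ← Real.sqrt_mul h0]
    exact Real.sqrt_le_iff.mpr ⟨norm_nonneg _, hsq⟩
  refine le_trans ?_ h1
  have h2 : min 1 m * (1 + r) ≤ r + m := by
    have := min_le_left 1 m
    have := min_le_right 1 m
    nlinarith
  calc _ = √((1 - κ) / 2) * (min 1 m * (1 + r)) := by ring
    _ ≤ _ := by gcongr

/-- Cauchy's theorem on a horizontal strip: if `f` is holomorphic there and tends to zero at both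
ends, the integrals over the two boundary lines agree. Only the difference of the boundary values has
to be integrable, as neither value need be when `f` decays like `1 / w`. -/
lemma integral_strip_eq_zero {f : ℂ → ℂ} {θ : ℝ} (hθ : 0 ≤ θ)
    (hf : DifferentiableOn ℂ f {w | |w.im| ≤ θ}) {b : ℝ → ℝ}
    (hb : Tendsto b (cocompact ℝ) (𝓝 0))
    (hfb : ∀ᶠ x : ℝ in cocompact ℝ, ∀ y : ℝ, |y| ≤ θ → ‖f (x + y * Complex.I)‖ ≤ b x)
    (hint : Integrable fun x : ℝ => f (x + θ * Complex.I) - f (x + (-θ : ℝ) * Complex.I)) :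
    ∫ x : ℝ, (f (x + θ * Complex.I) - f (x + (-θ : ℝ) * Complex.I)) = 0 := by
  have hlim := intervalIntegral_tendsto_integral hint tendsto_neg_atTop_atBot tendsto_id
  refine tendsto_nhds_unique hlim ?_
  have hrect : ∀ R : ℝ, ∫ x : ℝ in -R..R, (f (x + θ * Complex.I) - f (x + (-θ : ℝ) * Complex.I))
      = Complex.I * (∫ y in -θ..θ, f (R + y * Complex.I))
        - Complex.I * (∫ y in -θ..θ, f ((-R : ℝ) + y * Complex.I)) := by
    intro R
    have hcont : ∀ y : ℝ, |y| ≤ θ → Continuous fun x : ℝ => f (x + y * Complex.I) := by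
      intro y hy
      exact hf.continuousOn.comp_continuous (by fun_prop) (by intro x; simpa using hy)
    have := Complex.integral_boundary_rect_eq_zero_of_differentiableOn f
      (-R + (-θ : ℝ) * Complex.I) (R + θ * Complex.I) (hf.mono ?_)
    · rw [intervalIntegral.integral_sub ((hcont θ (abs_of_nonneg hθ).le).intervalIntegrable _ _)
        ((hcont (-θ) (by rw [abs_neg, abs_of_nonneg hθ])).intervalIntegrable _ _)]
      simp at this ⊢
      linear_combination -this
    · intro w hw
      have := hw.2
      simp [Set.uIcc_of_le (by linarith : -θ ≤ θ)] at this
      exact abs_le.mpr this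
  simp only [id]
  simp_rw [hrect]
  have side : ∀ u : ℝ → ℝ, Tendsto u atTop (cocompact ℝ) →
      Tendsto (fun R : ℝ => ∫ y in -θ..θ, f ((u R : ℝ) + y * Complex.I)) atTop (𝓝 0) := by
    intro u hu
    have h1 : Tendsto (fun R => b (u R) * |θ - -θ|) atTop (𝓝 0) := by
      simpa using (hb.comp hu).mul_const |θ - -θ|
    refine squeeze_zero_norm' ?_ h1
    filter_upwards [hu.eventually hfb] with R hR
    refine intervalIntegral.norm_integral_le_of_norm_le_const fun y hy => hR y ?_
    rw [Set.uIoc_of_le (by linarith)] at hy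
    exact abs_le.mpr ⟨hy.1.le, hy.2⟩
  have h1 := side (fun R => R) (by
    rw [cocompact_eq_atBot_atTop]; exact tendsto_id.mono_right le_sup_right)
  have h2 := side (fun R => -R) (by
    rw [cocompact_eq_atBot_atTop]; exact tendsto_neg_atTop_atBot.mono_right le_sup_left)
  simpa using (h1.const_mul Complex.I).sub (h2.const_mul Complex.I)

lemma integrable_exp_neg_mul_abs {μ : ℝ} (hμ : 0 < μ) :
    Integrable fun x : ℝ => Real.exp (-μ * |x|) := by
  have h : IntegrableOn (fun x : ℝ => Real.exp (-μ * |x|)) (Set.Ioi 0) :=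
    (integrableOn_exp_mul_Ioi (neg_lt_zero.mpr hμ) 0).congr_fun
      (fun x hx => by simp [abs_of_pos (Set.mem_Ioi.mp hx)]) measurableSet_Ioi
  have h' : IntegrableOn (fun x : ℝ => Real.exp (-μ * |x|)) (Set.Iic 0) :=
    (integrableOn_exp_mul_Iic hμ 0).congr_fun
      (fun x hx => by simp [abs_of_nonpos (Set.mem_Iic.mp hx)]) measurableSet_Iic
  rw [← integrableOn_univ, ← Set.Iic_union_Ioi (a := (0 : ℝ))]
  exact h'.union h

/-- The integral of a simple pole `1 / (w - c)` over the two boundary lines of a strip: the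
difference of the integrands is a Cauchy density. -/
lemma integral_inv_add_sub_inv_sub {θ : ℝ} (hθ : 0 < θ) (c : ℝ) :
    Integrable (fun x : ℝ => ((x + θ * Complex.I - c)⁻¹ - (x + (-θ : ℝ) * Complex.I - c)⁻¹ : ℂ)) ∧
    ∫ x : ℝ, ((x + θ * Complex.I - c)⁻¹ - (x + (-θ : ℝ) * Complex.I - c)⁻¹ : ℂ)
      = -2 * Real.pi * Complex.I := by
  have key : (fun x : ℝ => ((x + θ * Complex.I - c)⁻¹ - (x + (-θ : ℝ) * Complex.I - c)⁻¹ : ℂ))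
      = fun x : ℝ => (-2 * Complex.I * (θ⁻¹ : ℝ)) * (((1 + ((x - c) / θ) ^ 2)⁻¹ : ℝ) : ℂ) := by
    ext x
    have h1 : (x + θ * Complex.I - c : ℂ) ≠ 0 := by
      intro h
      have := congrArg Complex.im h
      simp at this
      exact hθ.ne' this
    have h2 : (x + (-θ : ℝ) * Complex.I - c : ℂ) ≠ 0 := by
      intro h
      have := congrArg Complex.im h
      simp at this
      exact hθ.ne' this
    have h3 : (1 + ((x - c) / θ) ^ 2 : ℂ) ≠ 0 := by
      have : (1 + ((x - c) / θ) ^ 2 : ℝ) ≠ 0 := by positivity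
      exact_mod_cast this
    have h4 : (θ : ℂ) ≠ 0 := by exact_mod_cast hθ.ne'
    have h5 : (θ ^ 2 + (x - c) ^ 2 : ℂ) ≠ 0 := by
      have : (θ ^ 2 + (x - c) ^ 2 : ℝ) ≠ 0 := by positivity
      exact_mod_cast this
    push_cast at h2 ⊢
    rw [inv_sub_inv h1 h2]
    have h6 : ((x : ℂ) + θ * Complex.I - c) * (x + -θ * Complex.I - c) = θ ^ 2 + (x - c) ^ 2 := by
      linear_combination (-(θ : ℂ) ^ 2) * Complex.I_sq
    rw [h6]
    have h7 : (1 + (((x : ℂ) - c) / θ) ^ 2) = (θ ^ 2 + (x - c) ^ 2) / θ ^ 2 := by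
      field_simp
    rw [h7]
    field_simp
    ring
  rw [key]
  have hi : Integrable fun x : ℝ => (1 + ((x - c) / θ) ^ 2)⁻¹ :=
    (integrable_inv_one_add_sq.comp_div hθ.ne').comp_sub_right c
  refine ⟨hi.ofReal.const_mul _, ?_⟩
  rw [integral_const_mul, integral_complex_ofReal]
  have : ∫ x : ℝ, (1 + ((x - c) / θ) ^ 2)⁻¹ = θ * Real.pi := by
    rw [integral_sub_right_eq_self (fun x : ℝ => (1 + (x / θ) ^ 2)⁻¹) c,
      Measure.integral_comp_div (fun x : ℝ => (1 + x ^ 2)⁻¹) θ, integral_univ_inv_one_add_sq,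
      abs_of_pos hθ, smul_eq_mul]
  rw [this]
  have h4 : (θ : ℂ) ≠ 0 := by exact_mod_cast hθ.ne'
  push_cast
  field_simp

/-- Cauchy's formula on a strip, for the kernel `exp w / (p - exp w)`, whose only pole in the strip
is `log p`. In the variable `s = exp w` the two boundary lines are the rays `arg s = ±θ`, the kernel
is `ds / (p - s)`, and the formula evaluates `H` at `s = p`. -/
lemma integral_strip_mul_eq {H : ℂ → ℂ} {θ μ C p : ℝ} (hμ : 0 < μ) (hθ : Real.pi / 2 < θ)
    (hθπ : θ < Real.pi) (hp : 0 < p)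
    (hH : DifferentiableOn ℂ H {w | |w.im| ≤ θ})
    (hHb : ∀ w : ℂ, |w.im| ≤ θ → ‖H w‖ ≤ C * Real.exp (-μ * |w.re|)) :
    ∫ x : ℝ, (Complex.exp (x + θ * Complex.I) / (p - Complex.exp (x + θ * Complex.I))
          * H (x + θ * Complex.I)
        - Complex.exp (x + (-θ : ℝ) * Complex.I) / (p - Complex.exp (x + (-θ : ℝ) * Complex.I))
          * H (x + (-θ : ℝ) * Complex.I))
      = 2 * Real.pi * Complex.I * H (Real.log p) := by
  have hθ0 : 0 < θ := by linarith [Real.pi_pos]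
  set S : Set ℂ := {w | |w.im| ≤ θ}
  set c : ℝ := Real.log p
  have hcp : Complex.exp c = p := by
    rw [← Complex.ofReal_exp, Real.exp_log hp]
  have hS : S ∈ 𝓝 (c : ℂ) := by
    have : ∀ᶠ w : ℂ in 𝓝 (c : ℂ), |w.im| < θ :=
      ContinuousAt.eventually_lt (by fun_prop) continuousAt_const (by simpa using hθ0)
    exact this.mono fun w hw => hw.le
  let D : ℂ → ℂ := fun w => p * Complex.exp (-w) - 1
  have hD : Differentiable ℂ D := by fun_prop
  have hDc : D c = 0 := by
    simp only [D]
    rw [Complex.exp_neg, hcp]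
    have : (p : ℂ) ≠ 0 := by exact_mod_cast hp.ne'
    field_simp; simp
  have hderiv : deriv D c = -1 := by
    have : HasDerivAt D (p * (Complex.exp (-c) * (-1))) c :=
      (((hasDerivAt_id (c : ℂ)).neg.cexp).const_mul (p : ℂ)).sub_const 1
    rw [this.deriv, Complex.exp_neg, hcp]
    have : (p : ℂ) ≠ 0 := by exact_mod_cast hp.ne'
    field_simp
  -- the only zero of `D` in the strip is `log p`
  have hD0 : ∀ w ∈ S, D w = 0 → w = c := by
    intro w hw h
    have h1 : Complex.exp w = Complex.exp c := by
      simp only [D, Complex.exp_neg] at h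
      rw [hcp]
      have := Complex.exp_ne_zero w
      field_simp at h
      linear_combination -h
    have h2 := abs_le.mp (show |w.im| ≤ θ from hw)
    exact Complex.exp_inj_of_neg_pi_lt_of_le_pi (by linarith) (by linarith)
      (by simp [Real.pi_pos]) (by simp [Real.pi_pos.le]) h1
  -- `δ` is `D` with its simple zero divided out, so `f` below is the integrand `H / D` minus its
  -- principal part `-H c / (w - c)`, and is holomorphic in the whole strip
  set δ : ℂ → ℂ := dslope D c
  have hδ : ∀ w : ℂ, w ≠ c → δ w = D w / (w - c) := fun w hw => by
    simp only [δ]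
    rw [dslope_of_ne _ hw, slope_def_field, hDc, sub_zero]
  have hδc : δ c = -1 := by simp only [δ]; rw [dslope_same, hderiv]
  have hδ0 : ∀ w ∈ S, δ w ≠ 0 := by
    intro w hw h
    by_cases hwc : w = c
    · rw [hwc, hδc] at h; norm_num at h
    · rw [hδ w hwc, div_eq_zero_iff] at h
      exact hwc (h.elim (hD0 w hw) fun h => sub_eq_zero.mp h)
  have hδd : DifferentiableOn ℂ δ S := (Complex.differentiableOn_dslope hS).mpr hD.differentiableOn
  let f : ℂ → ℂ := dslope (fun w => H w / δ w) c
  have hf : DifferentiableOn ℂ f S := (Complex.differentiableOn_dslope hS).mpr (hH.div hδd hδ0)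
  have hfe : ∀ w : ℂ, w ≠ c → f w = H w / D w + H c * (w - c)⁻¹ := by
    intro w hw
    have : w - c ≠ 0 := sub_ne_zero.mpr hw
    simp only [f]
    rw [dslope_of_ne _ hw, slope_def_field, hδc, hδ w hw]
    field_simp
    ring
  have hDe : ∀ w, (D w)⁻¹ = Complex.exp w / (p - Complex.exp w) := by
    intro w
    have h0 := Complex.exp_ne_zero w
    have : D w = (p - Complex.exp w) / Complex.exp w := by
      simp only [D, Complex.exp_neg]; field_simp
    rw [this, inv_div]
  have hne : ∀ (x : ℝ) (y : ℝ), y ≠ 0 → (x + y * Complex.I : ℂ) ≠ c := by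
    intro x y hy h
    have := congrArg Complex.im h
    simp at this
    exact hy this
  have hline : ∀ x y : ℝ, y ≠ 0 → f (x + y * Complex.I) =
      Complex.exp (x + y * Complex.I) / (p - Complex.exp (x + y * Complex.I))
          * H (x + y * Complex.I) + H c * (x + y * Complex.I - c)⁻¹ := by
    intro x y hy
    rw [hfe _ (hne x y hy), ← hDe, div_eq_inv_mul]
  -- integrability along the two boundary lines
  have hbd : ∀ y : ℝ, |y| = θ → Integrable fun x : ℝ =>
      Complex.exp (x + y * Complex.I) / (p - Complex.exp (x + y * Complex.I))
          * H (x + y * Complex.I) := by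
    intro y hy
    have hcos : Real.cos y < 0 := by
      rw [← Real.cos_abs, hy]
      exact Real.cos_neg_of_pi_div_two_lt_of_lt hθ (by linarith)
    have hlow : ∀ x : ℝ, -Real.cos y * Real.exp x ≤ ‖(p - Complex.exp (x + y * Complex.I) : ℂ)‖ := by
      intro x
      refine le_trans ?_ (Complex.re_le_norm _)
      simp [Complex.exp_re]
      nlinarith
    have hHc : Continuous fun x : ℝ => H (x + y * Complex.I) :=
      hH.continuousOn.comp_continuous (by fun_prop) (by intro x; simpa [S] using hy.le)
    refine Integrable.mono' (((integrable_exp_neg_mul_abs hμ).const_mul (C * (-Real.cos y)⁻¹)))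
      (Continuous.aestronglyMeasurable ?_) (ae_of_all _ fun x => ?_)
    · refine Continuous.mul (Continuous.div (by fun_prop) (by fun_prop) fun x => ?_) hHc
      rw [← norm_pos_iff]
      refine lt_of_lt_of_le ?_ (hlow x)
      have := Real.exp_pos x
      nlinarith
    · have h1 := hHb (x + y * Complex.I) (by simpa using hy.le)
      simp only [Complex.add_re, Complex.ofReal_re, Complex.mul_re, Complex.I_re, mul_zero,
        Complex.ofReal_im, Complex.I_im, mul_one, sub_self, add_zero] at h1
      have h2 : ‖Complex.exp (x + y * Complex.I) / (p - Complex.exp (x + y * Complex.I))‖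
          ≤ (-Real.cos y)⁻¹ := by
        rw [norm_div, Complex.norm_exp]
        have h3 := hlow x
        have hx := Real.exp_pos x
        simp only [Complex.add_re, Complex.ofReal_re, Complex.mul_re, Complex.I_re, mul_zero,
          Complex.ofReal_im, Complex.I_im, mul_one, sub_self, add_zero]
        rw [div_le_iff₀ (lt_of_lt_of_le (by nlinarith) h3), inv_mul_eq_div,
          le_div_iff₀ (by linarith)]
        linarith
      rw [norm_mul]
      calc _ ≤ (-Real.cos y)⁻¹ * (C * Real.exp (-μ * |x|)) :=
            mul_le_mul h2 h1 (norm_nonneg _) (by rw [inv_nonneg]; linarith)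
        _ = _ := by ring
  have hbp := hbd θ (abs_of_pos hθ0)
  have hbm := hbd (-θ) (by rw [abs_neg, abs_of_pos hθ0])
  obtain ⟨hi, hival⟩ := integral_inv_add_sub_inv_sub hθ0 c
  have hsplit : (fun x : ℝ => f (x + θ * Complex.I) - f (x + (-θ : ℝ) * Complex.I)) = fun x : ℝ =>
      (Complex.exp (x + θ * Complex.I) / (p - Complex.exp (x + θ * Complex.I))
          * H (x + θ * Complex.I)
        - Complex.exp (x + (-θ : ℝ) * Complex.I) / (p - Complex.exp (x + (-θ : ℝ) * Complex.I))
          * H (x + (-θ : ℝ) * Complex.I))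
      + H c * ((x + θ * Complex.I - c)⁻¹ - (x + (-θ : ℝ) * Complex.I - c)⁻¹ : ℂ) := by
    ext x
    rw [hline x θ hθ0.ne', hline x (-θ) (neg_ne_zero.mpr hθ0.ne')]
    ring
  have hint : Integrable fun x : ℝ => f (x + θ * Complex.I) - f (x + (-θ : ℝ) * Complex.I) := by
    rw [hsplit]
    exact (hbp.sub hbm).add (hi.const_mul _)
  have hzero := integral_strip_eq_zero hθ0.le hf
    (b := fun x => 2 * C * Real.exp (-μ * |x|) + ‖H c‖ * |x - c|⁻¹) ?_ ?_ hint
  · have hadd := integral_add (hbp.sub hbm) (hi.const_mul (H c))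
    simp only [Pi.sub_apply] at hadd
    rw [hsplit, hadd, integral_const_mul, hival] at hzero
    linear_combination hzero
  · have habs : Tendsto (fun x : ℝ => |x|) (cocompact ℝ) atTop := tendsto_norm_cocompact_atTop
    have h1 : Tendsto (fun x : ℝ => Real.exp (-μ * |x|)) (cocompact ℝ) (𝓝 0) :=
      Real.tendsto_exp_atBot.comp (habs.const_mul_atTop_of_neg (neg_lt_zero.mpr hμ))
    have h2 : Tendsto (fun x : ℝ => |x - c|⁻¹) (cocompact ℝ) (𝓝 0) := by
      refine tendsto_inv_atTop_zero.comp ?_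
      refine tendsto_atTop_mono (fun x => abs_sub_abs_le_abs_sub x c) ?_
      exact tendsto_atTop_add_const_right _ (-|c|) habs
    simpa using (h1.const_mul (2 * C)).add (h2.const_mul ‖H c‖)
  · have hlarge : ∀ᶠ x : ℝ in cocompact ℝ, (1 : ℝ) / 2 ≤ |p * Real.exp (-x) - 1| := by
      rw [cocompact_eq_atBot_atTop, eventually_sup]
      constructor
      · have : Tendsto (fun x : ℝ => p * Real.exp (-x)) atBot atTop :=
          (Real.tendsto_exp_atTop.comp tendsto_neg_atBot_atTop).const_mul_atTop hp
        filter_upwards [this.eventually_ge_atTop 2] with x hx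
        exact le_trans (by linarith) (le_abs_self _)
      · have : Tendsto (fun x : ℝ => p * Real.exp (-x)) atTop (𝓝 0) := by
          simpa using (Real.tendsto_exp_atBot.comp tendsto_neg_atTop_atBot).const_mul p
        filter_upwards [this.eventually_le_const (by norm_num : (0 : ℝ) < 1 / 2)] with x hx
        exact le_trans (by linarith) (neg_le_abs _)
    have hnec : ∀ᶠ x : ℝ in cocompact ℝ, x ≠ c := by
      exact (Set.finite_singleton c).isCompact.compl_mem_cocompact
    filter_upwards [hlarge, hnec] with x hx hxc y hy
    have hwc : (x + y * Complex.I : ℂ) ≠ c := by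
      intro h
      have := congrArg Complex.re h
      simp at this
      exact hxc this
    rw [hfe _ hwc]
    have h1 := hHb (x + y * Complex.I) (by simpa using hy)
    simp only [Complex.add_re, Complex.ofReal_re, Complex.mul_re, Complex.I_re, mul_zero,
        Complex.ofReal_im, Complex.I_im, mul_one, sub_self, add_zero] at h1
    have h2 : 1 / 2 ≤ ‖D (x + y * Complex.I)‖ := by
      refine hx.trans ?_
      have := abs_norm_sub_norm_le ((p : ℂ) * Complex.exp (-(x + y * Complex.I))) 1
      simpa [D, Complex.norm_exp, abs_of_pos hp] using this
    have h3 : |x - c| ≤ ‖(x + y * Complex.I - c : ℂ)‖ := by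
      refine le_trans (le_of_eq ?_) (Complex.abs_re_le_norm _)
      simp
    have h4 : 0 < |x - c| := abs_pos.mpr (sub_ne_zero.mpr hxc)
    refine (norm_add_le _ _).trans (add_le_add ?_ ?_)
    · rw [norm_div, div_le_iff₀ (by linarith)]
      have := norm_nonneg (H (x + y * Complex.I))
      nlinarith
    · rw [norm_mul, norm_inv]
      gcongr

/-! ### The resolvent kernel -/

/-- The Laplace transform of an integral of exponentials `exp (s t)` over the ray
`s = exp (x + φ i)` in the open left half-plane. On this ray `|s| / |Re s|` is constant, which makes
the double integral absolutely convergent. -/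
lemma rayIntegral_laplace {φ : ℝ} (hφ : Real.cos φ < 0) {h : ℝ → ℂ} (hh : Integrable h) :
    IntegrableOn (fun t : ℝ => ∫ x : ℝ, Complex.exp (Complex.exp (x + φ * Complex.I) * t)
        * (Complex.exp (x + φ * Complex.I) * h x)) (Set.Ioi 0) ∧
    ∀ p : ℝ, 0 < p →
      Integrable (fun x : ℝ => Complex.exp (x + φ * Complex.I)
        / (p - Complex.exp (x + φ * Complex.I)) * h x) ∧
      ∫ t in Set.Ioi (0 : ℝ), Complex.exp (-(p * t)) *
          ∫ x : ℝ, Complex.exp (Complex.exp (x + φ * Complex.I) * t)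
            * (Complex.exp (x + φ * Complex.I) * h x)
        = ∫ x : ℝ, Complex.exp (x + φ * Complex.I) / (p - Complex.exp (x + φ * Complex.I)) * h x := by
  set s : ℝ → ℂ := fun x => Complex.exp (x + φ * Complex.I)
  have hsre : ∀ x, (s x).re = Real.exp x * Real.cos φ := fun x => by simp [s, Complex.exp_re]
  have hsneg : ∀ x, (s x).re < 0 := fun x => by
    rw [hsre]; exact mul_neg_of_pos_of_neg (Real.exp_pos x) hφ
  have hsn : ∀ x, ‖s x‖ = Real.exp x := fun x => by simp [s, Complex.norm_exp]
  have hscont : Continuous s := by fun_prop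
  let G : ℝ × ℝ → ℂ := fun z => Complex.exp (s z.2 * z.1) * (s z.2 * h z.2)
  have hGm : AEStronglyMeasurable G ((volume.restrict (Set.Ioi 0)).prod volume) := by
    refine AEStronglyMeasurable.mul (Continuous.aestronglyMeasurable (by fun_prop)) ?_
    exact (Continuous.aestronglyMeasurable (by fun_prop)).mul hh.aestronglyMeasurable.comp_snd
  have hGi : Integrable G ((volume.restrict (Set.Ioi 0)).prod volume) := by
    rw [integrable_prod_iff' hGm]
    refine ⟨ae_of_all _ fun x =>
      (integrableOn_exp_mul_complex_Ioi (hsneg x) 0).mul_const (s x * h x), ?_⟩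
    have : (fun x : ℝ => ∫ t in Set.Ioi (0 : ℝ), ‖G (t, x)‖)
        = fun x => (-Real.cos φ)⁻¹ * ‖h x‖ := by
      ext x
      have h1 : ∀ t : ℝ, ‖G (t, x)‖ = Real.exp ((s x).re * t) * (Real.exp x * ‖h x‖) := by
        intro t
        simp only [G, norm_mul, hsn, Complex.norm_exp, Complex.re_mul_ofReal]
      simp_rw [h1]
      rw [integral_mul_const, integral_exp_mul_Ioi (hsneg x), hsre]
      have := Real.exp_pos x
      simp only [mul_zero, Real.exp_zero]
      field_simp
    rw [this]
    exact hh.norm.const_mul _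
  refine ⟨hGi.integral_prod_left, fun p hp => ?_⟩
  have hpi : Integrable (fun z : ℝ × ℝ => Complex.exp (-(p * z.1)) * G z)
      ((volume.restrict (Set.Ioi 0)).prod volume) := by
    refine hGi.mono ((Continuous.aestronglyMeasurable (by fun_prop)).mul hGm) ?_
    have h0 : ∀ᵐ z ∂((volume.restrict (Set.Ioi (0 : ℝ))).prod (volume : Measure ℝ)), 0 < z.1 :=
      Measure.quasiMeasurePreserving_fst.ae (ae_restrict_mem measurableSet_Ioi)
    filter_upwards [h0] with z hz
    rw [norm_mul]
    refine mul_le_of_le_one_left (norm_nonneg _) ?_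
    rw [Complex.norm_exp, Real.exp_le_one_iff]
    simp
    positivity
  have hswap := integral_integral_swap (f := fun t x : ℝ => Complex.exp (-(p * t)) * G (t, x)) hpi
  simp_rw [integral_const_mul] at hswap
  have hinner : (fun x : ℝ => ∫ t in Set.Ioi (0 : ℝ), Complex.exp (-(p * t)) * G (t, x))
      = fun x : ℝ => s x / (p - s x) * h x := by
    ext x
    have hne : (p : ℂ) - s x ≠ 0 := by
      intro h0
      have := congrArg Complex.re h0
      have := hsneg x
      simp at *
      linarith
    have hre : (s x - p).re < 0 := by
      have := hsneg x
      simp at *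
      linarith
    have h1 : ∀ t : ℝ, Complex.exp (-(p * t)) * G (t, x)
        = Complex.exp ((s x - p) * t) * (s x * h x) := by
      intro t
      simp only [G]
      rw [← mul_assoc, ← Complex.exp_add]
      congr 2
      ring
    simp only [h1]
    rw [integral_mul_const, integral_exp_mul_complex_Ioi hre]
    simp only [Complex.ofReal_zero, mul_zero, Complex.exp_zero]
    rw [← neg_sub (p : ℂ) (s x), neg_div_neg_eq]
    field_simp
  have hint := hpi.integral_prod_right
  rw [hinner] at hint hswap
  exact ⟨hint, hswap⟩

/-- The function `s ↦ 1 / (s ^ μ - l) + 1 / (l (1 + s))` in the logarithmic variable `w`,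
`s = exp w`. The second summand, the Laplace transform of `exp (-t) / l`, makes the sum vanish at
`s = 0` without spoiling its decay at infinity. -/
noncomputable def resolventSymbol (μ : ℝ) (l w : ℂ) : ℂ :=
  1 / (Complex.exp (μ * w) - l) + 1 / (l * (1 + Complex.exp w))

lemma resolventSymbol_bound {μ θ : ℝ} {l : ℂ} (hμ0 : 0 < μ) (hμ1 : μ < 1) (hθ : 0 ≤ θ)
    (hθπ : θ < Real.pi) (h : μ * θ < |l.arg|) :
    DifferentiableOn ℂ (resolventSymbol μ l) {w | |w.im| ≤ θ} ∧
    ∃ C, ∀ w : ℂ, |w.im| ≤ θ → ‖resolventSymbol μ l w‖ ≤ C * Real.exp (-μ * |w.re|) := by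
  have hl : l ≠ 0 := by
    rintro rfl
    simp at h
    nlinarith
  obtain ⟨δ₁, hδ₁, h₁⟩ := exists_le_norm_cexp_mul_sub hμ0 hθ h
  obtain ⟨δ₂, hδ₂, h₂⟩ := exists_le_norm_cexp_mul_sub (l := -1) one_pos hθ
    (by rw [Complex.arg_neg_one, abs_of_pos Real.pi_pos]; linarith)
  have h₂' : ∀ w : ℂ, |w.im| ≤ θ → δ₂ * (1 + Real.exp w.re) ≤ ‖1 + Complex.exp w‖ := by
    intro w hw
    simpa [add_comm] using h₂ w hw
  have hA : ∀ w : ℂ, |w.im| ≤ θ → Complex.exp (μ * w) - l ≠ 0 := fun w hw =>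
    norm_pos_iff.mp (lt_of_lt_of_le (by positivity) (h₁ w hw))
  have hB : ∀ w : ℂ, |w.im| ≤ θ → 1 + Complex.exp w ≠ 0 := fun w hw =>
    norm_pos_iff.mp (lt_of_lt_of_le (by positivity) (h₂' w hw))
  constructor
  · unfold resolventSymbol
    refine DifferentiableOn.add ?_ ?_
    · exact DifferentiableOn.div (by fun_prop) (by fun_prop) hA
    · exact DifferentiableOn.div (by fun_prop) (by fun_prop) fun w hw => mul_ne_zero hl (hB w hw)
  set m := ‖l‖
  have hm : 0 < m := norm_pos_iff.mpr hl
  refine ⟨2 * (m + 1) / (m * δ₁ * δ₂), fun w hw => ?_⟩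
  have hAw := hA w hw
  have hBw := hB w hw
  have e1 : resolventSymbol μ l w = (l * Complex.exp w + Complex.exp (μ * w)) /
      (l * (Complex.exp (μ * w) - l) * (1 + Complex.exp w)) := by
    unfold resolventSymbol
    field_simp
    ring
  set E := Real.exp w.re
  set F := Real.exp (μ * w.re)
  have hE : 0 < E := Real.exp_pos _
  have hF : 0 < F := Real.exp_pos _
  have hnum : ‖l * Complex.exp w + Complex.exp (μ * w)‖ ≤ (m + 1) * (E + F) := by
    refine (norm_add_le _ _).trans ?_
    rw [norm_mul, Complex.norm_exp, Complex.norm_exp, Complex.re_ofReal_mul]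
    change m * E + F ≤ _
    nlinarith
  have hden : m * (δ₁ * (1 + F)) * (δ₂ * (1 + E))
      ≤ ‖l * (Complex.exp (μ * w) - l) * (1 + Complex.exp w)‖ := by
    rw [norm_mul, norm_mul]
    gcongr
    · exact h₁ w hw
    · exact h₂' w hw
  rw [e1, norm_div]
  have key : E + F ≤ 2 * Real.exp (-μ * |w.re|) * ((1 + F) * (1 + E)) := by
    rcases le_total 0 w.re with hx | hx
    · have h3 : F ≤ E := Real.exp_le_exp.mpr (by nlinarith)
      have h4 : Real.exp (-μ * |w.re|) * F = 1 := by
        rw [← Real.exp_add, abs_of_nonneg hx]; simp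
      have h5 : 0 < Real.exp (-μ * |w.re|) := Real.exp_pos _
      calc E + F ≤ 2 * (Real.exp (-μ * |w.re|) * F) * E := by rw [h4]; linarith
        _ = 2 * Real.exp (-μ * |w.re|) * (F * E) := by ring
        _ ≤ _ := by gcongr <;> linarith
    · have h3 : E ≤ F := Real.exp_le_exp.mpr (by nlinarith)
      have h4 : Real.exp (-μ * |w.re|) = F := by
        rw [abs_of_nonpos hx]; simp only [F]; congr 1; ring
      rw [h4]
      have : 1 ≤ (1 + F) * (1 + E) := by nlinarith
      nlinarith
  calc _ ≤ (m + 1) * (E + F) / (m * (δ₁ * (1 + F)) * (δ₂ * (1 + E))) := by gcongr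
    _ ≤ (m + 1) * (2 * Real.exp (-μ * |w.re|) * ((1 + F) * (1 + E)))
        / (m * (δ₁ * (1 + F)) * (δ₂ * (1 + E))) := by gcongr
    _ = _ := by field_simp

/-- The resolvent kernel: if `|arg l| > μ π / 2`, there is an integrable function on `(0, ∞)` with
Laplace transform `1 / (p ^ μ - l)`. It is the inverse Laplace integral over two rays in the open
left half-plane, between which `s ^ μ = l` has no solution. -/
theorem exists_integrable_laplace_eq {μ : ℝ} {l : ℂ} (hμ0 : 0 < μ) (hμ1 : μ < 1)
    (hl : μ * Real.pi / 2 < |l.arg|) :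
    ∃ r : ℝ → ℂ, IntegrableOn r (Set.Ioi 0) ∧
      ∀ p : ℝ, 0 < p → ∫ t in Set.Ioi (0 : ℝ), Complex.exp (-(p * t)) * r t
        = 1 / (((p ^ μ : ℝ) : ℂ) - l) := by
  -- the rays `arg s = ±θ` lie in the left half-plane and leave the zeros of `s ^ μ - l` outside
  obtain ⟨θ, hθ1, hθ2⟩ : ∃ θ, Real.pi / 2 < θ ∧ θ < min Real.pi (|l.arg| / μ) := by
    refine exists_between (lt_min (by linarith [Real.pi_pos]) ?_)
    rw [lt_div_iff₀ hμ0]; linarith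
  have hθπ : θ < Real.pi := hθ2.trans_le (min_le_left _ _)
  have hθl : μ * θ < |l.arg| := by
    have := hθ2.trans_le (min_le_right _ _)
    rw [lt_div_iff₀ hμ0] at this; linarith
  have hθ0 : 0 < θ := by linarith [Real.pi_pos]
  have hl0 : l ≠ 0 := by
    rintro rfl
    simp at hl
    nlinarith [Real.pi_pos]
  obtain ⟨hHd, C, hHb⟩ := resolventSymbol_bound hμ0 hμ1 hθ0.le hθπ hθl
  set H := resolventSymbol μ l
  have hline : ∀ y : ℝ, |y| ≤ θ → Integrable fun x : ℝ => H (x + y * Complex.I) := by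
    intro y hy
    refine Integrable.mono' ((integrable_exp_neg_mul_abs hμ0).const_mul C)
      (Continuous.aestronglyMeasurable (hHd.continuousOn.comp_continuous (by fun_prop)
        (by intro x; simpa using hy))) (ae_of_all _ fun x => ?_)
    simpa using hHb (x + y * Complex.I) (by simpa using hy)
  have hcos : Real.cos θ < 0 := Real.cos_neg_of_pi_div_two_lt_of_lt hθ1 (by linarith)
  obtain ⟨hq1, hq2⟩ := rayIntegral_laplace hcos (hline θ (abs_of_pos hθ0).le)
  obtain ⟨hq1', hq2'⟩ := rayIntegral_laplace (by rwa [Real.cos_neg] : Real.cos (-θ) < 0)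
    (hline (-θ) (by rw [abs_neg, abs_of_pos hθ0]))
  set q := fun t : ℝ => ∫ x : ℝ, Complex.exp (Complex.exp (x + θ * Complex.I) * t)
        * (Complex.exp (x + θ * Complex.I) * H (x + θ * Complex.I))
  set q' := fun t : ℝ => ∫ x : ℝ, Complex.exp (Complex.exp (x + (-θ : ℝ) * Complex.I) * t)
        * (Complex.exp (x + (-θ : ℝ) * Complex.I) * H (x + (-θ : ℝ) * Complex.I))
  have hexp : ∀ p : ℝ, 0 < p →
      IntegrableOn (fun t : ℝ => Complex.exp (-(p : ℂ) * t)) (Set.Ioi 0) := fun p hp =>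
    integrableOn_exp_mul_complex_Ioi (by simpa using hp) 0
  have hweight : ∀ (p : ℝ), 0 < p → ∀ f : ℝ → ℂ, IntegrableOn f (Set.Ioi 0) →
      IntegrableOn (fun t : ℝ => Complex.exp (-(p * t)) * f t) (Set.Ioi 0) := by
    intro p hp f hf
    refine Integrable.mono hf
      ((Continuous.aestronglyMeasurable (by fun_prop)).mul hf.aestronglyMeasurable) ?_
    filter_upwards [ae_restrict_mem measurableSet_Ioi] with t ht
    have ht' : 0 < t := ht
    rw [norm_mul]
    refine mul_le_of_le_one_left (norm_nonneg _) ?_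
    rw [Complex.norm_exp, Real.exp_le_one_iff]
    simp
    positivity
  refine ⟨fun t => (2 * Real.pi * Complex.I)⁻¹ * (q t - q' t)
      - l⁻¹ * Complex.exp (-((1 : ℝ) : ℂ) * t),
    ((hq1.sub hq1').const_mul _).sub ((hexp 1 one_pos).const_mul _), fun p hp => ?_⟩
  have hstrip := integral_strip_mul_eq hμ0 hθ1 hθπ hp hHd hHb
  have hsplit : (fun t : ℝ => Complex.exp (-(p * t)) * ((2 * Real.pi * Complex.I)⁻¹ * (q t - q' t)
      - l⁻¹ * Complex.exp (-((1 : ℝ) : ℂ) * t)))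
      = fun t : ℝ => (2 * Real.pi * Complex.I)⁻¹ * (Complex.exp (-(p * t)) * q t
          - Complex.exp (-(p * t)) * q' t)
        - l⁻¹ * Complex.exp (-((1 + p : ℝ) : ℂ) * t) := by
    ext t
    have : Complex.exp (-((1 + p : ℝ) : ℂ) * t)
        = Complex.exp (-(p * t)) * Complex.exp (-((1 : ℝ) : ℂ) * t) := by
      rw [← Complex.exp_add]; congr 1; push_cast; ring
    rw [this]
    ring
  rw [hsplit]
  have hp1 : 0 < 1 + p := by linarith
  have w1 := hweight p hp q hq1
  have w2 := hweight p hp q' hq1'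
  have e1 := integral_sub (w1.sub w2 |>.const_mul (2 * Real.pi * Complex.I)⁻¹)
    ((hexp (1 + p) hp1).const_mul l⁻¹)
  have e2 := integral_sub w1 w2
  have e3 := integral_sub (hq2 p hp).1 (hq2' p hp).1
  simp only [Pi.sub_apply] at e1 e2
  rw [e1, integral_const_mul, integral_const_mul, e2, (hq2 p hp).2, (hq2' p hp).2, ← e3, hstrip,
    integral_exp_mul_complex_Ioi (by simp; linarith)]
  have hpow : Complex.exp (μ * Real.log p) = ((p ^ μ : ℝ) : ℂ) := by
    rw [Real.rpow_def_of_pos hp]; push_cast; rw [mul_comm]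
  have hlog : Complex.exp (Real.log p) = p := by
    rw [← Complex.ofReal_exp, Real.exp_log hp]
  simp only [H, resolventSymbol]
  rw [hpow, hlog]
  have n1 : (2 * Real.pi * Complex.I : ℂ) ≠ 0 := Complex.two_pi_I_ne_zero
  have n2 : (1 + p : ℂ) ≠ 0 := by exact_mod_cast hp1.ne'
  rw [inv_mul_cancel_left₀ n1]
  push_cast
  simp only [mul_zero, Complex.exp_zero]
  field_simp
  ring

/-- The total mass of the resolvent kernel is the value of its transform at `p = 0`. -/
lemma integral_eq_of_laplace_eq {μ : ℝ} {l : ℂ} (hμ0 : 0 < μ) (hl : l ≠ 0) {r : ℝ → ℂ}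
    (hr : IntegrableOn r (Set.Ioi 0))
    (h : ∀ p : ℝ, 0 < p → ∫ t in Set.Ioi (0 : ℝ), Complex.exp (-(p * t)) * r t
        = 1 / (((p ^ μ : ℝ) : ℂ) - l)) :
    ∫ t in Set.Ioi (0 : ℝ), r t = -l⁻¹ := by
  have h1 : Tendsto (fun p : ℝ => ∫ t in Set.Ioi (0 : ℝ), Complex.exp (-(p * t)) * r t)
      (𝓝[>] 0) (𝓝 (∫ t in Set.Ioi (0 : ℝ), r t)) := by
    refine tendsto_integral_filter_of_dominated_convergence (fun t => ‖r t‖)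
      (.of_forall fun p => (Continuous.aestronglyMeasurable (by fun_prop)).mul
        hr.aestronglyMeasurable) ?_ hr.norm (ae_of_all _ fun t => ?_)
    · filter_upwards [self_mem_nhdsWithin] with p hp
      filter_upwards [ae_restrict_mem measurableSet_Ioi] with t ht
      have ht' : 0 < t := ht
      have hp' : 0 < p := hp
      rw [norm_mul]
      refine mul_le_of_le_one_left (norm_nonneg _) ?_
      rw [Complex.norm_exp, Real.exp_le_one_iff]
      simp
      positivity
    · refine tendsto_nhdsWithin_of_tendsto_nhds ?_
      have : Continuous fun p : ℝ => Complex.exp (-(p * t)) * r t := by fun_prop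
      simpa using this.tendsto 0
  have h2 : Tendsto (fun p : ℝ => 1 / (((p ^ μ : ℝ) : ℂ) - l)) (𝓝[>] 0) (𝓝 (-l⁻¹)) := by
    have h3 : Tendsto (fun p : ℝ => ((p ^ μ : ℝ) : ℂ)) (𝓝[>] 0) (𝓝 0) := by
      refine tendsto_nhdsWithin_of_tendsto_nhds ?_
      have : ContinuousAt (fun p : ℝ => ((p ^ μ : ℝ) : ℂ)) 0 :=
        Complex.continuous_ofReal.continuousAt.comp
          (Real.continuousAt_rpow_const 0 μ (Or.inr hμ0.le))
      simpa [ContinuousAt, Real.zero_rpow hμ0.ne'] using this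
    have h4 := (h3.sub_const l).inv₀ (by simpa using hl)
    simpa [inv_neg] using h4
  refine tendsto_nhds_unique h1 (h2.congr' ?_)
  filter_upwards [self_mem_nhdsWithin] with p hp
  exact (h p hp).symm

/-! ### Uniqueness of the Laplace transform -/

lemma integral_polynomial_exp_smul_eq_zero {f : ℝ → ℂ} (hf : IntegrableOn f (Set.Ioi 0))
    (h : ∀ n : ℕ, ∫ t in Set.Ioi (0 : ℝ), Complex.exp (-(n * t)) * f t = 0) (P : Polynomial ℝ) :
    IntegrableOn (fun t => P.eval (Real.exp (-t)) • f t) (Set.Ioi 0) ∧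
    ∫ t in Set.Ioi (0 : ℝ), P.eval (Real.exp (-t)) • f t = 0 := by
  induction P using Polynomial.induction_on' with
  | add P Q hP hQ =>
    have e : (fun t : ℝ => (P + Q).eval (Real.exp (-t)) • f t)
        = (fun t : ℝ => P.eval (Real.exp (-t)) • f t) + fun t : ℝ => Q.eval (Real.exp (-t)) • f t := by
      ext t; simp [add_mul]
    rw [e]
    refine ⟨hP.1.add hQ.1, ?_⟩
    rw [integral_add' hP.1 hQ.1, hP.2, hQ.2, add_zero]
  | monomial n a =>
    have e : (fun t : ℝ => (Polynomial.monomial n a).eval (Real.exp (-t)) • f t)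
        = fun t : ℝ => (a : ℂ) * (Complex.exp (-(n * t)) * f t) := by
      ext t
      rw [Polynomial.eval_monomial, ← Real.exp_nat_mul, Complex.real_smul]
      push_cast
      rw [mul_neg]
      ring
    rw [e]
    refine ⟨Integrable.const_mul ?_ _, by rw [integral_const_mul, h, mul_zero]⟩
    refine Integrable.mono hf
      ((Continuous.aestronglyMeasurable (by fun_prop)).mul hf.aestronglyMeasurable) ?_
    filter_upwards [ae_restrict_mem measurableSet_Ioi] with t ht
    have ht' : 0 < t := ht
    rw [norm_mul]
    refine mul_le_of_le_one_left (norm_nonneg _) ?_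
    rw [Complex.norm_exp, Real.exp_le_one_iff]
    simp
    positivity

/-- Lerch's theorem: an integrable function on `(0, ∞)` whose Laplace transform vanishes at all
natural numbers is zero almost everywhere. The substitution `x = exp (-t)` turns the hypothesis into
vanishing moments, so that the Weierstrass approximation theorem applies. -/
theorem ae_eq_zero_of_laplace_nat_eq_zero {f : ℝ → ℂ} (hf : IntegrableOn f (Set.Ioi 0))
    (h : ∀ n : ℕ, ∫ t in Set.Ioi (0 : ℝ), Complex.exp (-(n * t)) * f t = 0) :
    ∀ᵐ t, t ∈ Set.Ioi (0 : ℝ) → f t = 0 := by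
  refine isOpen_Ioi.ae_eq_zero_of_integral_contDiff_smul_eq_zero hf.locallyIntegrableOn ?_
  intro g hg hgc hgs
  have hset : ∫ t, g t • f t = ∫ t in Set.Ioi (0 : ℝ), g t • f t := by
    refine (setIntegral_eq_integral_of_forall_compl_eq_zero fun t ht => ?_).symm
    rw [image_eq_zero_of_notMem_tsupport fun hh => ht (hgs hh), zero_smul]
  have hg0 : g 0 = 0 := image_eq_zero_of_notMem_tsupport fun hh => lt_irrefl (0 : ℝ) (hgs hh)
  -- `x ↦ g (-log x)` is continuous at `0` too: it vanishes near `0` as `g` has compact support,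
  -- and at `0` by the convention `log 0 = 0`, as `g 0 = 0`
  have hΦ : ContinuousOn (fun x : ℝ => g (-Real.log x)) (Set.Icc 0 1) := by
    intro x hx
    refine ContinuousAt.continuousWithinAt ?_
    by_cases hx0 : x = 0
    · subst hx0
      rw [continuousAt_iff_punctured_nhds, Real.log_zero, neg_zero, hg0]
      have h1 : Tendsto (fun x : ℝ => -Real.log x) (𝓝[≠] 0) (cocompact ℝ) := by
        rw [cocompact_eq_atBot_atTop]
        exact (tendsto_neg_atBot_atTop.comp Real.tendsto_log_nhdsNE_zero).mono_right le_sup_right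
      have h2 : ∀ᶠ y in cocompact ℝ, g y = 0 := by
        filter_upwards [hgc.isCompact.compl_mem_cocompact] with y hy
        exact image_eq_zero_of_notMem_tsupport hy
      exact tendsto_const_nhds.congr' ((h1.eventually h2).mono fun y hy => hy.symm)
    · exact hg.continuous.continuousAt.comp (Real.continuousAt_log hx0).neg
  rw [hset]
  set M := ∫ t in Set.Ioi (0 : ℝ), ‖f t‖
  have hM : 0 ≤ M := integral_nonneg fun t => norm_nonneg _
  have hgi : IntegrableOn (fun t => g t • f t) (Set.Ioi 0) := by
    obtain ⟨B, hB⟩ := hgc.exists_bound_of_continuous hg.continuous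
    exact hf.bdd_smul B hg.continuous.aestronglyMeasurable (ae_of_all _ hB)
  rw [← norm_le_zero_iff]
  refine le_of_forall_pos_le_add fun ε hε => ?_
  obtain ⟨P, hP⟩ := exists_polynomial_near_of_continuousOn 0 1 _ hΦ (ε / (M + 1)) (by positivity)
  obtain ⟨hPi, hP0⟩ := integral_polynomial_exp_smul_eq_zero hf h P
  rw [zero_add, ← sub_zero (∫ t in Set.Ioi (0 : ℝ), g t • f t), ← hP0, ← integral_sub hgi hPi]
  calc ‖∫ t in Set.Ioi (0 : ℝ), (g t • f t - P.eval (Real.exp (-t)) • f t)‖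
      ≤ ∫ t in Set.Ioi (0 : ℝ), ε / (M + 1) * ‖f t‖ := by
        refine norm_integral_le_of_norm_le (hf.norm.const_mul _) ?_
        filter_upwards [ae_restrict_mem measurableSet_Ioi] with t ht
        have ht' : 0 < t := ht
        rw [← sub_smul, norm_smul]
        gcongr
        have := hP (Real.exp (-t)) ⟨(Real.exp_pos _).le, by rw [Real.exp_le_one_iff]; linarith⟩
        rw [Real.log_exp, neg_neg, abs_sub_comm] at this
        exact this.le
    _ = ε / (M + 1) * M := integral_const_mul _ _
    _ ≤ ε := by
        rw [div_mul_eq_mul_div, div_le_iff₀ (by positivity)]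
        nlinarith

/-! ### Weighted convolutions and the resolvent equation -/

/-- The function `t ↦ exp (-c t) f t` on `(0, ∞)`, extended by zero. The weight makes kernels such as
`1` and `t ^ (-μ)` integrable on the line, and it is compatible with convolution. -/
noncomputable def causalWeight (c : ℝ) (f : ℝ → ℂ) : ℝ → ℂ :=
  (Set.Ioi 0).indicator fun t => Complex.exp (-(c * t)) * f t

lemma causalWeight_conv_apply (c : ℝ) (f g : ℝ → ℂ) {x : ℝ} (hx : 0 ≤ x) :
    convolution (causalWeight c f) (causalWeight c g) (ContinuousLinearMap.mul ℂ ℂ) volume x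
      = Complex.exp (-(c * x)) * ∫ s in (0 : ℝ)..x, f (x - s) * g s := by
  rw [convolution_mul_swap, intervalIntegral.integral_of_le hx, ← integral_const_mul,
    integral_Ioc_eq_integral_Ioo, ← integral_indicator measurableSet_Ioo]
  refine integral_congr_ae (ae_of_all _ fun s => ?_)
  by_cases h1 : 0 < s
  · by_cases h2 : s < x
    · simp only [causalWeight, Set.indicator, Set.mem_Ioi, Set.mem_Ioo, sub_pos, h1, h2, and_self,
        if_true]
      have : Complex.exp (-(c * x)) = Complex.exp (-(c * (x - s : ℝ))) * Complex.exp (-(c * s)) := by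
        rw [← Complex.exp_add]; congr 1; push_cast; ring
      rw [this]
      ring
    · simp [causalWeight, Set.indicator, h2]
  · simp [causalWeight, Set.indicator, h1]

lemma causalWeight_conv_apply_of_nonpos (c : ℝ) (f g : ℝ → ℂ) {x : ℝ} (hx : x ≤ 0) :
    convolution (causalWeight c f) (causalWeight c g) (ContinuousLinearMap.mul ℂ ℂ) volume x
      = 0 := by
  rw [convolution_mul_swap]
  refine integral_eq_zero_of_ae (ae_of_all _ fun s => ?_)
  by_cases h1 : 0 < s
  · have : ¬ s < x := by linarith
    simp [causalWeight, Set.indicator, this]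
  · simp [causalWeight, Set.indicator, h1]

lemma causalWeight_conv_eq (c d : ℝ) (f g : ℝ → ℂ) (x : ℝ) :
    convolution (causalWeight (c + d) f) (causalWeight (c + d) g)
        (ContinuousLinearMap.mul ℂ ℂ) volume x
      = Complex.exp (-(c * x)) *
        convolution (causalWeight d f) (causalWeight d g) (ContinuousLinearMap.mul ℂ ℂ) volume x := by
  rcases le_total 0 x with hx | hx
  · rw [causalWeight_conv_apply _ _ _ hx, causalWeight_conv_apply _ _ _ hx, ← mul_assoc,
      ← Complex.exp_add]
    congr 2
    push_cast; ring
  · simp [causalWeight_conv_apply_of_nonpos _ _ _ hx]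

lemma integrable_causalWeight {c d : ℝ} (hcd : c ≤ d) {f : ℝ → ℂ}
    (hf : Integrable (causalWeight c f)) : Integrable (causalWeight d f) := by
  unfold causalWeight at *
  rw [integrable_indicator_iff measurableSet_Ioi] at *
  have e : (fun t : ℝ => Complex.exp (-(d * t)) * f t)
      = fun t : ℝ => Complex.exp (-((d - c : ℝ) * t)) * (Complex.exp (-(c * t)) * f t) := by
    ext t
    rw [← mul_assoc, ← Complex.exp_add]
    congr 2
    push_cast; ring
  rw [e]
  refine Integrable.mono hf
    ((Continuous.aestronglyMeasurable (by fun_prop)).mul hf.aestronglyMeasurable) ?_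
  filter_upwards [ae_restrict_mem measurableSet_Ioi] with t ht
  have ht' : 0 < t := ht
  rw [norm_mul]
  refine mul_le_of_le_one_left (norm_nonneg _) ?_
  rw [Complex.norm_exp, Real.exp_le_one_iff]
  have : 0 ≤ (d - c) * t := mul_nonneg (sub_nonneg.mpr hcd) ht'.le
  simpa using this

lemma integral_causalWeight (c : ℝ) (f : ℝ → ℂ) :
    ∫ t, causalWeight c f t = ∫ t in Set.Ioi (0 : ℝ), Complex.exp (-(c * t)) * f t :=
  integral_indicator measurableSet_Ioi

lemma integral_exp_mul_conv (n : ℕ) {f g : ℝ → ℂ} (hf : Integrable (causalWeight 1 f))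
    (hg : Integrable (causalWeight 1 g)) :
    ∫ x : ℝ, Complex.exp (-(n * x)) *
        convolution (causalWeight 1 f) (causalWeight 1 g) (ContinuousLinearMap.mul ℂ ℂ) volume x
      = (∫ t in Set.Ioi (0 : ℝ), Complex.exp (-((n + 1 : ℝ) * t)) * f t)
        * ∫ t in Set.Ioi (0 : ℝ), Complex.exp (-((n + 1 : ℝ) * t)) * g t := by
  have hn : (1 : ℝ) ≤ n + 1 := by simp
  have h := integral_convolution (ContinuousLinearMap.mul ℂ ℂ)
    (integrable_causalWeight hn hf) (integrable_causalWeight hn hg)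
  simp_rw [causalWeight_conv_eq] at h
  rw [integral_causalWeight, integral_causalWeight] at h
  simpa using h

lemma ae_convolution_assoc {u v w : ℝ → ℂ} (hu : Integrable u) (hv : Integrable v)
    (hw : Integrable w) : ∀ᵐ x,
      convolution (convolution u v (ContinuousLinearMap.mul ℂ ℂ) volume) w
        (ContinuousLinearMap.mul ℂ ℂ) volume x
      = convolution u (convolution v w (ContinuousLinearMap.mul ℂ ℂ) volume)
        (ContinuousLinearMap.mul ℂ ℂ) volume x := by
  have h1 := hu.norm.ae_convolution_exists (ContinuousLinearMap.mul ℝ ℝ)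
    (hv.norm.integrable_convolution (ContinuousLinearMap.mul ℝ ℝ) hw.norm)
  filter_upwards [h1] with x hx
  exact convolution_assoc _ _ _ _ (fun a b c => mul_assoc a b c) hu.aestronglyMeasurable
    hv.aestronglyMeasurable hw.aestronglyMeasurable (hu.ae_convolution_exists _ hv)
    (hv.norm.ae_convolution_exists _ hw.norm) hx

/-- The kernel `t ^ (-μ) / Γ(1 - μ)` of the Caputo derivative. -/
noncomputable def caputoKernel (μ : ℝ) (t : ℝ) : ℂ :=
  ((1 / Real.Gamma (1 - μ) * t ^ (-μ) : ℝ) : ℂ)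

lemma caputoKernel_laplace {μ : ℝ} (hμ1 : μ < 1) {p : ℝ} (hp : 0 < p) :
    Integrable (causalWeight p (caputoKernel μ)) ∧
    ∫ t in Set.Ioi (0 : ℝ), Complex.exp (-(p * t)) * caputoKernel μ t = ((p ^ μ / p : ℝ) : ℂ) := by
  have hG : 0 < Real.Gamma (1 - μ) := Real.Gamma_pos_of_pos (by linarith)
  have e : (fun t : ℝ => Complex.exp (-(p * t)) * caputoKernel μ t)
      = fun t : ℝ => ((1 / Real.Gamma (1 - μ) * (t ^ ((1 - μ) - 1) * Real.exp (-(p * t))) : ℝ) : ℂ) := by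
    ext t
    unfold caputoKernel
    rw [show (1 - μ) - 1 = -μ by ring]
    push_cast
    ring
  have hi : IntegrableOn (fun t : ℝ => t ^ ((1 - μ) - 1) * Real.exp (-(p * t))) (Set.Ioi 0) := by
    have := integrableOn_rpow_mul_exp_neg_mul_rpow (s := (1 - μ) - 1) (p := 1) (b := p)
      (by linarith) one_pos hp
    simpa [neg_mul] using this
  unfold causalWeight
  rw [integrable_indicator_iff measurableSet_Ioi, e]
  refine ⟨(hi.const_mul _).ofReal, ?_⟩
  rw [integral_complex_ofReal, integral_const_mul,
    Real.integral_rpow_mul_exp_neg_mul_Ioi (by linarith) hp]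
  congr 1
  rw [one_div p, Real.inv_rpow hp.le, Real.rpow_sub hp, Real.rpow_one]
  field_simp

/-- The resolvent equation `r * k = 1 + l (r * 1)`, where `k` is the Caputo kernel: both sides have
Laplace transform `p ^ (μ - 1) / (p ^ μ - l)`. -/
lemma resolvent_conv_caputoKernel {μ : ℝ} (hμ1 : μ < 1) {l : ℂ} (hl : l.arg ≠ 0)
    {r : ℝ → ℂ} (hr : IntegrableOn r (Set.Ioi 0))
    (h : ∀ p : ℝ, 0 < p → ∫ t in Set.Ioi (0 : ℝ), Complex.exp (-(p * t)) * r t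
        = 1 / (((p ^ μ : ℝ) : ℂ) - l)) :
    convolution (causalWeight 1 r) (causalWeight 1 (caputoKernel μ))
        (ContinuousLinearMap.mul ℂ ℂ) volume
      =ᵐ[volume] causalWeight 1 (fun _ => 1) +
        l • convolution (causalWeight 1 r) (causalWeight 1 (fun _ => 1))
          (ContinuousLinearMap.mul ℂ ℂ) volume := by
  have hR : Integrable (causalWeight 1 r) := by
    refine integrable_causalWeight zero_le_one ?_
    unfold causalWeight
    rw [integrable_indicator_iff measurableSet_Ioi]
    simpa using hr
  have hK := (caputoKernel_laplace hμ1 one_pos).1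
  have h1L : ∀ p : ℝ, 0 < p → Integrable (causalWeight p (fun _ => 1)) ∧
      ∫ t in Set.Ioi (0 : ℝ), Complex.exp (-(p * t)) * (1 : ℂ) = 1 / p := by
    intro p hp
    have h0 : (-(p : ℂ)).re < 0 := by simpa using hp
    unfold causalWeight
    rw [integrable_indicator_iff measurableSet_Ioi]
    simp only [mul_one, ← neg_mul]
    refine ⟨integrableOn_exp_mul_complex_Ioi h0 0, ?_⟩
    rw [integral_exp_mul_complex_Ioi h0]
    simp
  have hO := (h1L 1 one_pos).1
  set RK := convolution (causalWeight 1 r) (causalWeight 1 (caputoKernel μ))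
        (ContinuousLinearMap.mul ℂ ℂ) volume with hRK
  set RO := convolution (causalWeight 1 r) (causalWeight 1 (fun _ => 1))
        (ContinuousLinearMap.mul ℂ ℂ) volume with hRO
  have hRKi : Integrable RK := hR.integrable_convolution _ hK
  have hROi : Integrable RO := hR.integrable_convolution _ hO
  set F : ℝ → ℂ := RK - (causalWeight 1 (fun _ => 1) + l • RO) with hF
  have hFi : Integrable F := hRKi.sub (hO.add (hROi.smul l))
  have hFneg : ∀ t ≤ 0, F t = 0 := by
    intro t ht
    have a1 : RK t = 0 := causalWeight_conv_apply_of_nonpos _ _ _ ht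
    have a2 : RO t = 0 := causalWeight_conv_apply_of_nonpos _ _ _ ht
    simp [hF, a1, a2, causalWeight, ht]
  have hFL : ∀ n : ℕ, ∫ t in Set.Ioi (0 : ℝ), Complex.exp (-(n * t)) * F t = 0 := by
    intro n
    have hn : (0 : ℝ) < n + 1 := by positivity
    have hsupp : ∀ G : ℝ → ℂ, Integrable G → (∀ t ≤ 0, G t = 0) →
        Integrable fun t : ℝ => Complex.exp (-(n * t)) * G t := by
      intro G hG hG0
      refine hG.mono ((Continuous.aestronglyMeasurable (by fun_prop)).mul hG.aestronglyMeasurable)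
        (ae_of_all _ fun t => ?_)
      rcases le_or_gt t 0 with ht | ht
      · simp [hG0 t ht]
      rw [norm_mul]
      refine mul_le_of_le_one_left (norm_nonneg _) ?_
      rw [Complex.norm_exp, Real.exp_le_one_iff]
      simp
      positivity
    have i1 := hsupp RK hRKi fun t ht => causalWeight_conv_apply_of_nonpos _ _ _ ht
    have i2 := hsupp RO hROi fun t ht => causalWeight_conv_apply_of_nonpos _ _ _ ht
    have i3 := hsupp (causalWeight 1 (fun _ => 1)) hO fun t ht => by simp [causalWeight, ht]
    have j1 := integral_exp_mul_conv n hR hK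
    have j2 := integral_exp_mul_conv n hR hO
    have j3 : ∫ t : ℝ, Complex.exp (-(n * t)) * causalWeight 1 (fun _ => 1) t
        = 1 / ((n + 1 : ℝ) : ℂ) := by
      rw [← (h1L _ hn).2, ← integral_causalWeight]
      refine integral_congr_ae (ae_of_all _ fun t => ?_)
      by_cases ht : 0 < t
      · simp only [causalWeight, Set.indicator, Set.mem_Ioi, ht, if_true, mul_one]
        rw [← Complex.exp_add]; congr 1; push_cast; ring
      · simp [causalWeight, ht]
    rw [setIntegral_eq_integral_of_forall_compl_eq_zero fun t ht => by
      rw [hFneg t (not_lt.mp ht), mul_zero]]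
    have e : (fun t : ℝ => Complex.exp (-(n * t)) * F t)
        = fun t : ℝ => Complex.exp (-(n * t)) * RK t
          - (Complex.exp (-(n * t)) * causalWeight 1 (fun _ => 1) t
            + l * (Complex.exp (-(n * t)) * RO t)) := by
      ext t
      simp only [hF, Pi.sub_apply, Pi.add_apply, Pi.smul_apply, smul_eq_mul]
      ring
    have j4 := integral_sub i1 (i3.add (i2.const_mul l))
    have j5 := integral_add i3 (i2.const_mul l)
    simp only [Pi.add_apply] at j4
    push_cast at j1 j2 j3
    have l1 := h _ hn
    have l2 := (caputoKernel_laplace hμ1 hn).2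
    have l3 := (h1L _ hn).2
    push_cast at l1 l2 l3
    rw [e, j4, j5, integral_const_mul, j1, j2, j3, l1, l2, l3]
    have hne : (((n + 1 : ℝ) ^ μ : ℝ) : ℂ) - l ≠ 0 := by
      intro h0
      apply hl
      rw [← sub_eq_zero.mp h0]
      exact Complex.arg_ofReal_of_nonneg (by positivity)
    have hn' : (n + 1 : ℂ) ≠ 0 := by exact_mod_cast hn.ne'
    field_simp
    ring
  have := ae_eq_zero_of_laplace_nat_eq_zero hFi.integrableOn hFL
  filter_upwards [this] with t ht
  have : F t = 0 := by
    rcases le_or_gt t 0 with h0 | h0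
    · exact hFneg t h0
    · exact ht h0
  exact sub_eq_zero.mp this

/-! ### The perturbed scalar equation -/

/-- Convolution with an integrable kernel preserves limits at infinity, up to the mass of the
kernel. -/
lemma tendsto_integral_conv_of_tendsto {r h : ℝ → ℂ} {L : ℂ} (hr : IntegrableOn r (Set.Ioi 0))
    (hh : ContinuousOn h (Set.Ici 0)) (hL : Tendsto h atTop (𝓝 L)) :
    Tendsto (fun x : ℝ => ∫ s in (0 : ℝ)..x, r (x - s) * h s) atTop
      (𝓝 ((∫ t in Set.Ioi (0 : ℝ), r t) * L)) := by
  obtain ⟨B, hB⟩ : ∃ B, ∀ t, 0 ≤ t → ‖h t‖ ≤ B := by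
    obtain ⟨T, hT⟩ := eventually_atTop.mp (hL.norm.eventually_le_const (lt_add_one ‖L‖))
    obtain ⟨B, hB⟩ := (isCompact_Icc (a := (0 : ℝ)) (b := T)).exists_bound_of_continuousOn
      (hh.mono fun t ht => ht.1)
    refine ⟨max B (‖L‖ + 1), fun t ht => ?_⟩
    rcases le_total t T with h1 | h1
    · exact (hB t ⟨ht, h1⟩).trans (le_max_left _ _)
    · exact (hT t h1).trans (le_max_right _ _)
  have e : ∀ x : ℝ, 0 ≤ x → ∫ s in (0 : ℝ)..x, r (x - s) * h s
      = ∫ s in Set.Ioi (0 : ℝ), r s * (Set.Iic x).indicator (fun s => h (x - s)) s := by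
    intro x hx
    have h1 := intervalIntegral.integral_comp_sub_left (a := 0) (b := x)
      (fun s => r s * h (x - s)) x
    simp only [sub_sub_cancel, sub_self, sub_zero] at h1
    have h2 : (fun s => r s * (Set.Iic x).indicator (fun s => h (x - s)) s)
        = (Set.Iic x).indicator fun s => r s * h (x - s) := by
      ext s
      by_cases hs : s ∈ Set.Iic x <;> simp [hs]
    rw [h1, intervalIntegral.integral_of_le hx, h2, setIntegral_indicator measurableSet_Iic,
      Set.Ioi_inter_Iic]
  have hlim : Tendsto (fun x : ℝ => ∫ s in Set.Ioi (0 : ℝ),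
      r s * (Set.Iic x).indicator (fun s => h (x - s)) s) atTop
      (𝓝 (∫ t in Set.Ioi (0 : ℝ), r t * L)) := by
    refine tendsto_integral_filter_of_dominated_convergence (fun s => ‖r s‖ * max B 0)
      (.of_forall fun x => hr.aestronglyMeasurable.mul ?_)
      (.of_forall fun x => ae_of_all _ fun s => ?_) (hr.norm.mul_const _)
      (ae_of_all _ fun s => ?_)
    · refine AEStronglyMeasurable.restrict ?_
      rw [aestronglyMeasurable_indicator_iff measurableSet_Iic]
      refine ContinuousOn.aestronglyMeasurable (hh.comp (by fun_prop) fun s hs => ?_)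
        measurableSet_Iic
      simpa using hs
    · rw [norm_mul]
      gcongr
      by_cases hs : s ≤ x
      · rw [Set.indicator_of_mem (by simpa using hs)]
        exact (hB _ (sub_nonneg.mpr hs)).trans (le_max_left _ _)
      · rw [Set.indicator_of_notMem (by simpa using hs)]
        simp
    · refine Tendsto.const_mul _ ?_
      have h2 : Tendsto (fun x : ℝ => h (x - s)) atTop (𝓝 L) :=
        hL.comp (tendsto_atTop_add_const_right _ (-s) tendsto_id)
      refine h2.congr' ?_
      filter_upwards [eventually_ge_atTop s] with x hx
      rw [Set.indicator_of_mem (by simpa using hx)]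
  rw [integral_mul_const] at hlim
  refine hlim.congr' ?_
  filter_upwards [eventually_ge_atTop 0] with x hx
  exact (e x hx).symm

lemma norm_le_of_ae_norm_le {y : ℝ → ℂ} {X ε : ℝ} (hy : ContinuousOn y (Set.Ioi X))
    (h : ∀ᵐ x, X < x → ‖y x‖ ≤ ε) : ∀ x, X < x → ‖y x‖ ≤ ε := by
  intro x hx
  have hd := Measure.dense_of_ae h
  have hcl : x ∈ closure (Set.Ioi X ∩ {x | X < x → ‖y x‖ ≤ ε}) :=
    hd.open_subset_closure_inter isOpen_Ioi hx
  have := ContinuousWithinAt.mem_closure ((hy x hx).mono Set.inter_subset_left) hcl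
    (t := Metric.closedBall 0 ε) (fun z hz => by simpa using hz.2 hz.1)
  rw [Metric.isClosed_closedBall.closure_eq] at this
  simpa using this

/-- Variation of constants for `D^μ y = l y + g`, where `f` is the derivative of `y`: convolving the
equation `k * f = l y + g` with the resolvent kernel `r` and using the resolvent equation gives
`y = y 0 + r * (g + l y 0)`. The associativity of the convolution used here holds only for almost
every `x`. -/
lemma ae_eq_of_caputo_linear {μ : ℝ} (hμ1 : μ < 1) {l : ℂ} (hl : l.arg ≠ 0) {r : ℝ → ℂ}
    (hr : IntegrableOn r (Set.Ioi 0))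
    (h : ∀ p : ℝ, 0 < p → ∫ t in Set.Ioi (0 : ℝ), Complex.exp (-(p * t)) * r t
        = 1 / (((p ^ μ : ℝ) : ℂ) - l))
    {y f g : ℝ → ℂ} (hf : ∀ T > 0, IntervalIntegrable f volume 0 T)
    (hyf : ∀ t > 0, ∫ s in (0 : ℝ)..t, f s = y t - y 0)
    (heq : ∀ t > 0, ∫ s in (0 : ℝ)..t, caputoKernel μ (t - s) * f s = l * y t + g t) :
    ∀ᵐ x, 0 < x → y x = y 0 + ∫ s in (0 : ℝ)..x, r (x - s) * (g s + l * y 0) := by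
  suffices H : ∀ T : ℕ, ∀ᵐ x, 0 < x → x < (T + 1 : ℝ) →
      y x = y 0 + ∫ s in (0 : ℝ)..x, r (x - s) * (g s + l * y 0) by
    filter_upwards [ae_all_iff.mpr H] with x hx h0
    obtain ⟨n, hn⟩ := exists_nat_gt x
    exact hx n h0 (by linarith)
  intro N
  set T : ℝ := N + 1
  have hT : 0 < T := by positivity
  -- `f` may grow too fast for any exponential weight, and is cut off at `T`; convolutions at points
  -- of `(0, T)` do not see the cut
  set f₁ : ℝ → ℂ := (Set.Iio T).indicator f
  have hR : Integrable (causalWeight 1 r) := by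
    refine integrable_causalWeight zero_le_one ?_
    unfold causalWeight
    rw [integrable_indicator_iff measurableSet_Ioi]
    simpa using hr
  have hK := (caputoKernel_laplace hμ1 one_pos).1
  have hO : Integrable (causalWeight 1 (fun _ => 1)) := by
    unfold causalWeight
    rw [integrable_indicator_iff measurableSet_Ioi]
    simpa using integrableOn_exp_mul_complex_Ioi (a := -1) (by simp) 0
  have hF : Integrable (causalWeight 1 f₁) := by
    refine integrable_causalWeight zero_le_one ?_
    unfold causalWeight
    rw [integrable_indicator_iff measurableSet_Ioi]
    simp only [Complex.ofReal_zero, zero_mul, neg_zero, Complex.exp_zero, one_mul]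
    change Integrable ((Set.Iio T).indicator f) _
    rw [integrable_indicator_iff measurableSet_Iio, IntegrableOn,
      Measure.restrict_restrict measurableSet_Iio, Set.inter_comm, Set.Ioi_inter_Iio]
    exact ((intervalIntegrable_iff_integrableOn_Ioc_of_le hT.le).mp (hf T hT)).mono_set
      Set.Ioo_subset_Ioc_self
  have hRK := resolvent_conv_caputoKernel hμ1 hl hr h
  set R := causalWeight 1 r
  set K := causalWeight 1 (caputoKernel μ) with hKdef
  set O := causalWeight 1 (fun _ => 1) with hOdef
  set F := causalWeight 1 f₁ with hFdef
  let M := ContinuousLinearMap.mul ℂ ℂ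
  have hROi : Integrable (convolution R O M volume) := hR.integrable_convolution _ hO
  have hKFi : Integrable (convolution K F M volume) := hK.integrable_convolution _ hF
  have hOFi : Integrable (convolution O F M volume) := hO.integrable_convolution _ hF
  -- the convolutions with `f` on `(-∞, T)`
  have hcong : ∀ (k : ℝ → ℂ) (u : ℝ), 0 < u → u < T →
      convolution (causalWeight 1 k) F M volume u
        = Complex.exp (-u) * ∫ s in (0 : ℝ)..u, k (u - s) * f s := by
    intro k u hu huT
    rw [hFdef, causalWeight_conv_apply _ _ _ hu.le, Complex.ofReal_one, one_mul]
    congr 1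
    refine intervalIntegral.integral_congr fun s hs => ?_
    rw [Set.uIcc_of_le hu.le] at hs
    simp only [f₁]
    rw [Set.indicator_of_mem (by simpa using lt_of_le_of_lt hs.2 huT)]
  set G : ℝ → ℂ := convolution K F M volume - l • convolution O F M volume with hG
  have hGeq : ∀ u < T, G u = causalWeight 1 (fun s => g s + l * y 0) u := by
    intro u huT
    rcases le_or_gt u 0 with hu | hu
    · have a1 : convolution K F M volume u = 0 := causalWeight_conv_apply_of_nonpos _ _ _ hu
      have a2 : convolution O F M volume u = 0 := causalWeight_conv_apply_of_nonpos _ _ _ hu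
      simp [hG, a1, a2, causalWeight, hu]
    · have a1 := hcong (caputoKernel μ) u hu huT
      have a2 := hcong (fun _ => 1) u hu huT
      simp only [one_mul] at a2
      rw [heq u hu] at a1
      rw [hyf u hu] at a2
      simp only [hG, Pi.sub_apply, Pi.smul_apply, smul_eq_mul]
      rw [hKdef, hOdef, a1, a2]
      simp only [causalWeight, Set.indicator, Set.mem_Ioi, hu, if_true, Complex.ofReal_one, one_mul]
      ring
  have hRG : ∀ x, 0 < x → x < T → convolution R G M volume x
      = Complex.exp (-x) * ∫ s in (0 : ℝ)..x, r (x - s) * (g s + l * y 0) := by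
    intro x hx hxT
    have := causalWeight_conv_apply 1 r (fun s => g s + l * y 0) hx.le
    rw [Complex.ofReal_one, one_mul] at this
    rw [← this, convolution_def, convolution_def]
    refine integral_congr_ae (ae_of_all _ fun s => ?_)
    by_cases hs : 0 < s
    · simp only
      rw [hGeq (x - s) (by linarith)]
    · simp [R, causalWeight, hs]
  filter_upwards [ae_convolution_assoc hR hK hF, ae_convolution_assoc hR hO hF,
    hO.ae_convolution_exists M hF, hROi.ae_convolution_exists M hF,
    hR.ae_convolution_exists M hKFi, hR.ae_convolution_exists M hOFi]
    with x h1 h2 h3 h4 h5 h6 hx hxT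
  have e1 : convolution R G M volume x
      = convolution R (convolution K F M volume) M volume x
        - l * convolution R (convolution O F M volume) M volume x := by
    rw [hG, sub_eq_add_neg, ← neg_smul]
    have h6' : ConvolutionExistsAt R ((-l) • convolution O F M volume) x M volume := by
      refine (Integrable.smul (-l) h6).congr (ae_of_all _ fun t => ?_)
      simp [M]
      ring
    rw [h5.distrib_add h6', convolution_smul]
    simp
    ring
  have e2 : convolution (convolution R K M volume) F M volume x
      = convolution O F M volume x + l * convolution (convolution R O M volume) F M volume x := by
    rw [convolution_congr M hRK (ae_eq_refl F)]
    have h4' : ConvolutionExistsAt (l • convolution R O M volume) F x M volume := by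
      refine (Integrable.smul l h4).congr (ae_of_all _ fun t => ?_)
      simp [M]
      ring
    rw [h3.add_distrib h4', smul_convolution]
    simp
  have e3 := hcong (fun _ => 1) x hx hxT
  simp only [one_mul] at e3
  rw [hyf x hx] at e3
  have e4 := hRG x hx hxT
  have : Complex.exp (-x) * (y x - y 0)
      = Complex.exp (-x) * ∫ s in (0 : ℝ)..x, r (x - s) * (g s + l * y 0) := by
    rw [← e3, ← e4, e1, ← h1, ← h2, e2]
    ring
  rw [← mul_left_cancel₀ (Complex.exp_ne_zero _) this]
  ring

/-- Asymptotic stability of the scalar equation `D^μ y = l y + g` with `|arg l| > μ π / 2` and a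
vanishing perturbation `g`. In the variation of constants formula the integral tends to
`(-l⁻¹) (l y 0)`, which cancels the initial value. -/
theorem tendsto_zero_of_caputo_linear {μ : ℝ} (hμ0 : 0 < μ) (hμ1 : μ < 1) {l : ℂ}
    (hl : μ * Real.pi / 2 < |l.arg|) {y f g : ℝ → ℂ}
    (hf : ∀ T > 0, IntervalIntegrable f volume 0 T)
    (hy : ContinuousOn y (Set.Ici 0)) (hg : ContinuousOn g (Set.Ici 0))
    (hg0 : Tendsto g atTop (𝓝 0))
    (hyf : ∀ t > 0, ∫ s in (0 : ℝ)..t, f s = y t - y 0)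
    (heq : ∀ t > 0, ∫ s in (0 : ℝ)..t, caputoKernel μ (t - s) * f s = l * y t + g t) :
    Tendsto y atTop (𝓝 0) := by
  have harg : l.arg ≠ 0 := by
    intro h
    rw [h, abs_zero] at hl
    nlinarith [Real.pi_pos]
  have hl0 : l ≠ 0 := by
    rintro rfl
    simp at harg
  obtain ⟨r, hr, hrL⟩ := exists_integrable_laplace_eq hμ0 hμ1 hl
  have hae := ae_eq_of_caputo_linear hμ1 harg hr hrL hf hyf heq
  have hlim : Tendsto (fun x : ℝ => y 0 + ∫ s in (0 : ℝ)..x, r (x - s) * (g s + l * y 0)) atTop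
      (𝓝 0) := by
    have := (tendsto_integral_conv_of_tendsto (h := fun s => g s + l * y 0) hr
      (hg.add continuousOn_const) (by simpa using hg0.add_const (l * y 0))).const_add (y 0)
    have e : y 0 + -l⁻¹ * (l * y 0) = 0 := by field_simp; ring
    rwa [integral_eq_of_laplace_eq hμ0 hl0 hr hrL, e] at this
  rw [Metric.tendsto_nhds]
  intro ε hε
  obtain ⟨X, hX⟩ := eventually_atTop.mp (hlim.norm.eventually_le_const
    (show ‖(0 : ℂ)‖ < ε / 2 by simpa using hε))
  have hb := norm_le_of_ae_norm_le (y := y) (X := max X 0) (ε := ε / 2)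
    (hy.mono fun t ht => (lt_of_le_of_lt (le_max_right _ _) (Set.mem_Ioi.mp ht)).le) (by
      filter_upwards [hae] with x hx hxX
      rw [hx (lt_of_le_of_lt (le_max_right _ _) hxX)]
      exact hX x (le_of_lt (lt_of_le_of_lt (le_max_left _ _) hxX)))
  filter_upwards [eventually_gt_atTop (max X 0)] with x hx
  rw [dist_zero_right]
  linarith [hb x hx]

/-! ### The error system and its stability -/

lemma AbsolutelyContinuousOnInterval.add_const_mul {f g : ℝ → ℝ} {a b : ℝ} (c : ℝ)
    (hf : AbsolutelyContinuousOnInterval f a b) (hg : AbsolutelyContinuousOnInterval g a b) :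
    AbsolutelyContinuousOnInterval (fun s => f s + c * g s) a b :=
  hf.add (hg.const_mul c)

lemma HasCaputoDerivAt.add_const_mul {μ t v w : ℝ} {f g : ℝ → ℝ} (c : ℝ)
    (hf : AbsolutelyContinuousOnInterval f 0 t) (hg : AbsolutelyContinuousOnInterval g 0 t)
    (hfv : HasCaputoDerivAt μ f v t) (hgw : HasCaputoDerivAt μ g w t) :
    HasCaputoDerivAt μ (fun s => f s + c * g s) (v + c * w) t := by
  have hae : ∀ᵐ s, s ∈ Set.uIoc 0 t → deriv f s / (t - s) ^ μ + c * (deriv g s / (t - s) ^ μ)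
      = deriv (fun s => f s + c * g s) s / (t - s) ^ μ := by
    filter_upwards [hf.ae_differentiableAt, hg.ae_differentiableAt] with s h1 h2 hs
    have h1' := (h1 (Set.uIoc_subset_uIcc hs)).hasDerivAt
    have h2' := (h2 (Set.uIoc_subset_uIcc hs)).hasDerivAt
    have h3 : HasDerivAt (fun s => f s + c * g s) (deriv f s + c * deriv g s) s :=
      h1'.add (h2'.const_mul c)
    rw [h3.deriv]
    ring
  refine ⟨(hfv.intervalIntegrable.add (hgw.intervalIntegrable.const_mul c)).congr_ae ?_, ?_⟩
  · exact (ae_restrict_iff' measurableSet_uIoc).mpr hae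
  · rw [← intervalIntegral.integral_congr_ae hae, intervalIntegral.integral_add
      hfv.intervalIntegrable (hgw.intervalIntegrable.const_mul c),
      intervalIntegral.integral_const_mul, hfv.eq_integral, hgw.eq_integral]
    ring

/-- The closed-loop error system. Only the total control acting on `z + w` enters. -/
lemma isCaputoSolution_syncError {a b c α μ : ℝ} (hα : α ≠ 0) {C : Matrix (Fin 3) (Fin 3) ℝ}
    {x y z w u u' : ℝ → Fin 3 → ℝ}
    (hx : IsCaputoSolution μ x (fun t => chenField a b c (x t)))
    (hy : IsCaputoSolution μ y (fun t => chenField a b c (y t)))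
    (hz : IsCaputoSolution μ z (fun t => chenField a b c (z t) + u t))
    (hw : IsCaputoSolution μ w (fun t => chenField a b c (w t) + u' t))
    (hu : ∀ t > 0, u t + u' t = totalControl a c α
      (C.mulVec (syncError α (x t) (y t) (z t) (w t))) (x t) (y t) (z t) (w t)) :
    IsCaputoSolution μ (fun t => syncError α (x t) (y t) (z t) (w t))
      (fun t => (errorMatrix a b c + C).mulVec (syncError α (x t) (y t) (z t) (w t))) := by
  -- each error component is a fixed linear combination of the four states
  let d : Fin 3 → Fin 3 → ℝ := ![![1, -1, -1], ![1, 1, 1], ![1, -α, -α]]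
  have he : ∀ i, (fun t => syncError α (x t) (y t) (z t) (w t) i)
      = fun t => x t i + d i 0 * y t i + d i 1 * z t i + d i 2 * w t i := by
    intro i
    ext t
    fin_cases i <;> simp [syncError, d] <;> ring
  constructor
  · intro i T hT
    rw [he i]
    exact (((hx.1 i T hT).add_const_mul _ (hy.1 i T hT)).add_const_mul _
      (hz.1 i T hT)).add_const_mul _ (hw.1 i T hT)
  · intro t ht i
    rw [he i]
    have a1 := (hx.1 i t ht).add_const_mul (d i 0) (hy.1 i t ht)
    have a2 := a1.add_const_mul (d i 1) (hz.1 i t ht)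
    have h1 := (hx.2 t ht i).add_const_mul (d i 0) (hx.1 i t ht) (hy.1 i t ht) (hy.2 t ht i)
    have h2 := h1.add_const_mul (d i 1) a1 (hz.1 i t ht) (hz.2 t ht i)
    have h3 := h2.add_const_mul (d i 2) a2 (hw.1 i t ht) (hw.2 t ht i)
    convert h3 using 1
    have hu0 := congrFun (hu t ht) 0
    have hu1 := congrFun (hu t ht) 1
    have hu2 := congrFun (hu t ht) 2
    rw [Matrix.add_mulVec]
    generalize C.mulVec (syncError α (x t) (y t) (z t) (w t)) = V at *
    simp only [totalControl, Pi.add_apply, Matrix.cons_val_zero, Matrix.cons_val_one,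
      Matrix.cons_val] at hu0 hu1 hu2
    fin_cases i
    · simp [errorMatrix, syncError, d, chenField]
      linear_combination hu0
    · simp [errorMatrix, syncError, d, chenField]
      linear_combination -hu1
    · simp [errorMatrix, syncError, d, chenField]
      have hα' : α * (1 / α) = 1 := by field_simp
      linear_combination α * hu2 + (-V 2 + x t 0 * x t 1 + y t 0 * y t 1 - α * z t 0 * z t 1
        - α * w t 0 * w t 1) * hα'

lemma IsCaputoSolution.integral_caputoKernel {μ : ℝ} {x F : ℝ → Fin 3 → ℝ}
    (hx : IsCaputoSolution μ x F) {t : ℝ} (ht : 0 < t) (i : Fin 3) :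
    IntervalIntegrable (fun s => caputoKernel μ (t - s) * ((deriv (fun s => x s i) s : ℝ) : ℂ))
      volume 0 t ∧
    ∫ s in (0 : ℝ)..t, caputoKernel μ (t - s) * ((deriv (fun s => x s i) s : ℝ) : ℂ) = (F t i : ℂ) := by
  have h := hx.2 t ht i
  have e : ∀ s ∈ Set.uIcc 0 t,
      ((1 / Real.Gamma (1 - μ) * (deriv (fun s => x s i) s / (t - s) ^ μ) : ℝ) : ℂ)
      = caputoKernel μ (t - s) * ((deriv (fun s => x s i) s : ℝ) : ℂ) := by
    intro s hs
    rw [Set.uIcc_of_le ht.le] at hs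
    unfold caputoKernel
    rw [Real.rpow_neg (sub_nonneg.mpr hs.2)]
    push_cast
    ring
  constructor
  · have h0 := h.1.const_mul (1 / Real.Gamma (1 - μ))
    exact IntervalIntegrable.congr (fun s hs => e s (Set.uIoc_subset_uIcc hs))
      ⟨h0.1.ofReal, h0.2.ofReal⟩
  · rw [← intervalIntegral.integral_congr e, intervalIntegral.integral_ofReal,
      intervalIntegral.integral_const_mul, ← h.2]

/-- Matignon's theorem: under the sector condition every solution of `D^μ e = M e` tends to zero.
The functionals `φ` with `φ · e → 0` form a subspace. If `φ` is a generalized eigenvector of the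
transpose `N` of `M` for `l`, then `y = φ · e` solves `D^μ y = l y + g` with `g = ((N - l) φ) · e`,
so induction along the chain of `φ` puts every generalized eigenvector into the subspace. -/
theorem IsCaputoSolution.tendsto_zero {μ : ℝ} (hμ0 : 0 < μ) (hμ1 : μ < 1)
    {M : Matrix (Fin 3) (Fin 3) ℝ} (hM : SectorCondition μ M) {e : ℝ → Fin 3 → ℝ}
    (he : IsCaputoSolution μ e fun t => M.mulVec (e t)) (i : Fin 3) :
    Tendsto (fun t => e t i) atTop (𝓝 0) := by
  set N : Matrix (Fin 3) (Fin 3) ℂ := (M.map Complex.ofReal).transpose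
  let Y : (Fin 3 → ℂ) → ℝ → ℂ := fun φ t => ∑ i, φ i * (e t i : ℂ)
  let S : Submodule ℂ (Fin 3 → ℂ) :=
    { carrier := {φ | Tendsto (Y φ) atTop (𝓝 0)}
      zero_mem' := by simp [Y]
      add_mem' := fun {φ ψ} hφ hψ => by
        have := Tendsto.add hφ hψ
        simpa [Y, add_mul, Finset.sum_add_distrib] using this
      smul_mem' := fun k φ hφ => by
        have := Tendsto.const_mul k hφ
        simpa [Y, Finset.mul_sum, mul_assoc] using this }
  have hcont : ∀ φ, ContinuousOn (Y φ) (Set.Ici 0) := by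
    intro φ
    refine continuousOn_finsetSum _ fun i _ => continuousOn_const.mul ?_
    refine Complex.continuous_ofReal.comp_continuousOn fun t ht => ?_
    have ht' : (0 : ℝ) ≤ t := ht
    have h1 := (he.1 i (t + 1) (by linarith)).continuousOn
    rw [Set.uIcc_of_le (by linarith)] at h1
    refine (h1 t ⟨ht', by linarith⟩).mono_of_mem_nhdsWithin ?_
    rw [← Set.Ici_inter_Iic]
    exact inter_mem_nhdsWithin _ (Iic_mem_nhds (by linarith))
  have hdi : ∀ T > 0, ∀ i, IntervalIntegrable (fun t => ((deriv (fun s => e s i) t : ℝ) : ℂ))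
      volume 0 T := fun T hT i =>
    have h := (he.1 i T hT).intervalIntegrable_deriv
    ⟨h.1.ofReal, h.2.ofReal⟩
  have hstep : ∀ (l : ℂ) (φ : Fin 3 → ℂ), μ * Real.pi / 2 < |l.arg| →
      (N.toLin' - l • 1) φ ∈ S → φ ∈ S := by
    intro l φ hl hφ
    refine tendsto_zero_of_caputo_linear hμ0 hμ1 hl
      (f := fun t => ∑ i, φ i * ((deriv (fun s => e s i) t : ℝ) : ℂ)) (g := Y ((N.toLin' - l • 1) φ))
      ?_ (hcont φ) (hcont _) hφ ?_ ?_
    · intro T hT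
      have h1 := IntervalIntegrable.sum Finset.univ fun i _ => (hdi T hT i).const_mul (φ i)
      have h2 : (fun t => ∑ i, φ i * ((deriv (fun s => e s i) t : ℝ) : ℂ))
          = ∑ i, fun t => φ i * ((deriv (fun s => e s i) t : ℝ) : ℂ) := by
        ext t
        simp
      rw [h2]
      exact h1
    · intro t ht
      rw [intervalIntegral.integral_finsetSum fun i _ => (hdi t ht i).const_mul (φ i),
        ← Finset.sum_sub_distrib]
      refine Finset.sum_congr rfl fun i _ => ?_
      rw [intervalIntegral.integral_const_mul, intervalIntegral.integral_ofReal,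
        (he.1 i t ht).integral_deriv_eq_sub]
      push_cast
      ring
    · intro t ht
      have h1 : ∀ s : ℝ, caputoKernel μ (t - s)
          * ∑ i, φ i * ((deriv (fun s => e s i) s : ℝ) : ℂ)
          = ∑ i, φ i * (caputoKernel μ (t - s) * ((deriv (fun s => e s i) s : ℝ) : ℂ)) := by
        intro s
        rw [Finset.mul_sum]
        exact Finset.sum_congr rfl fun i _ => by ring
      simp_rw [h1]
      rw [intervalIntegral.integral_finsetSum fun i _ =>
        (he.integral_caputoKernel ht i).1.const_mul (φ i)]
      simp_rw [intervalIntegral.integral_const_mul, fun i => (he.integral_caputoKernel ht i).2]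
      simp only [Y, N, LinearMap.sub_apply, Matrix.toLin'_apply, LinearMap.smul_apply,
        Module.End.one_apply, Pi.sub_apply, Pi.smul_apply, smul_eq_mul, Matrix.mulVec, dotProduct,
        Matrix.transpose_apply, Matrix.map_apply, Fin.sum_univ_three]
      push_cast
      ring
  have hN : ∀ l : ℂ, Module.End.HasEigenvalue N.toLin' l → μ * Real.pi / 2 < |l.arg| := by
    intro l hl
    refine hM l ?_
    rw [Module.End.hasEigenvalue_iff_mem_spectrum, Matrix.spectrum_toLin',
      Matrix.mem_spectrum_iff_isRoot_charpoly, Matrix.charpoly_transpose,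
      ← Matrix.mem_spectrum_iff_isRoot_charpoly] at hl
    exact hl
  have htop : S = ⊤ := by
    rw [eq_top_iff, ← Module.End.iSup_maxGenEigenspace_eq_top N.toLin']
    refine iSup_le fun l φ hφ => ?_
    obtain ⟨k, hk⟩ := (Module.End.mem_maxGenEigenspace _ _ _).mp hφ
    by_cases hl : Module.End.HasEigenvalue N.toLin' l
    · clear hφ
      induction k generalizing φ with
      | zero =>
        have : φ = 0 := by simpa using hk
        rw [this]; exact S.zero_mem
      | succ k ih =>
        refine hstep l φ (hN l hl) (ih _ ?_)
        rwa [pow_succ] at hk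
    · -- off the spectrum `N - l` is injective, so the generalized eigenspace is trivial
      have hinj : Function.Injective
          (N.toLin' - l • (1 : Module.End ℂ (Fin 3 → ℂ))) := by
        rw [← LinearMap.ker_eq_bot, ← Module.End.eigenspace_def]
        exact not_not.mp hl
      have h0 := (hinj.iterate k) (a₁ := φ) (a₂ := 0) (by
        rw [← Module.End.pow_apply, ← Module.End.pow_apply, hk, map_zero])
      rw [h0]; exact S.zero_mem
  have hi : (Pi.single i 1 : Fin 3 → ℂ) ∈ S := htop ▸ Submodule.mem_top
  have h1 : Tendsto (fun t => (e t i : ℂ)) atTop (𝓝 0) := by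
    have : Tendsto (Y (Pi.single i 1)) atTop (𝓝 0) := hi
    simpa [Y, Pi.single_apply] using this
  simpa [Function.comp_def] using (Complex.continuous_re.tendsto 0).comp h1

/-! ### The sector condition for the two gain matrices -/

lemma sectorCondition_diagonal {μ : ℝ} (hμ0 : 0 < μ) (hμ1 : μ < 1) (d : Fin 3 → ℝ) :
    SectorCondition μ (Matrix.diagonal d) ↔ ∀ i, d i < 0 := by
  unfold SectorCondition
  rw [Matrix.diagonal_map (by simp), spectrum_diagonal, Set.forall_mem_range]
  refine forall_congr' fun i => ?_
  rcases lt_or_ge (d i) 0 with h | h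
  · simp only [h, iff_true]
    rw [Complex.arg_ofReal_of_neg h, abs_of_pos Real.pi_pos]
    nlinarith [Real.pi_pos]
  · simp only [h.not_gt, iff_false]
    rw [Complex.arg_ofReal_of_nonneg h, abs_zero, not_lt]
    positivity

/-- The gains are chosen so as to cancel the off-diagonal entries of the error system. -/
lemma errorMatrix_add_gainMatrix (a b c l : ℝ) :
    errorMatrix a b c + gainMatrix a b c l = Matrix.diagonal ![c - a - l, -l, -l] := by
  ext i j
  fin_cases i <;> fin_cases j <;> simp [errorMatrix, gainMatrix] <;> ring

lemma errorMatrix_add_gainMatrix' (a b c l : ℝ) :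
    errorMatrix a b c + gainMatrix' a b c l = Matrix.diagonal ![-l, -l, -l] := by
  ext i j
  fin_cases i <;> fin_cases j <;> simp [errorMatrix, gainMatrix'] <;> ring

theorem mainTheorem1 (a b c α μ : ℝ) (hα : α ≠ 0) (hμ0 : 0 < μ) (hμ1 : μ < 1) :
    (∀ (C : Matrix (Fin 3) (Fin 3) ℝ) (x y z w u u' : ℝ → Fin 3 → ℝ),
      IsCaputoSolution μ x (fun t => chenField a b c (x t)) →
      IsCaputoSolution μ y (fun t => chenField a b c (y t)) →
      IsCaputoSolution μ z (fun t => chenField a b c (z t) + u t) →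
      IsCaputoSolution μ w (fun t => chenField a b c (w t) + u' t) →
      ((∀ t > 0, (u t, u' t) = controlsCase1 a c α
          (C.mulVec (syncError α (x t) (y t) (z t) (w t))) (x t) (y t) (z t) (w t)) ∨
        (∀ t > 0, (u t, u' t) = controlsCase2 a c α
          (C.mulVec (syncError α (x t) (y t) (z t) (w t))) (x t) (y t) (z t) (w t))) →
      IsCaputoSolution μ (fun t => syncError α (x t) (y t) (z t) (w t))
          (fun t => (errorMatrix a b c + C).mulVec (syncError α (x t) (y t) (z t) (w t))) ∧
        (SectorCondition μ (errorMatrix a b c + C) →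
          Tendsto (fun t => (x t 0 + y t 0) - (z t 0 + w t 0)) atTop (𝓝 0) ∧
          Tendsto (fun t => (x t 1 + y t 1) + (z t 1 + w t 1)) atTop (𝓝 0) ∧
          Tendsto (fun t => (x t 2 + y t 2) - α * (z t 2 + w t 2)) atTop (𝓝 0))) ∧
    (∀ l : ℝ, SectorCondition μ (errorMatrix a b c + gainMatrix a b c l) ↔ 0 < l ∧ c - a < l) ∧
    (∀ l : ℝ, SectorCondition μ (errorMatrix a b c + gainMatrix' a b c l) ↔ 0 < l) := by
  refine ⟨fun C x y z w u u' hx hy hz hw hc => ?_, fun l => ?_, fun l => ?_⟩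
  · have hu : ∀ t > 0, u t + u' t = totalControl a c α
        (C.mulVec (syncError α (x t) (y t) (z t) (w t))) (x t) (y t) (z t) (w t) := by
      intro t ht
      rcases hc with h | h
      · obtain ⟨h1, h2⟩ := Prod.mk.inj (h t ht)
        rw [h1, h2, ← add_smul]
        norm_num
      · obtain ⟨h1, h2⟩ := Prod.mk.inj (h t ht)
        rw [h1, h2, add_zero]
    have he := isCaputoSolution_syncError hα hx hy hz hw hu
    exact ⟨he, fun hM => ⟨he.tendsto_zero hμ0 hμ1 hM 0, he.tendsto_zero hμ0 hμ1 hM 1,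
      he.tendsto_zero hμ0 hμ1 hM 2⟩⟩
  · rw [errorMatrix_add_gainMatrix, sectorCondition_diagonal hμ0 hμ1]
    simp [Fin.forall_fin_succ, and_comm]
  · rw [errorMatrix_add_gainMatrix', sectorCondition_diagonal hμ0 hμ1]
    simp [Fin.forall_fin_succ]
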